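/- Let $k$ be an algebraically closed field of characteristic $0$, let $\mathbb K=\bigcup_{m\ge1}k((x^{1/m}))$ be the field of Puiseux series over $k$ with its $x$-adic absolute value, $\hat{\mathbb K}$ its completion, and $G=\mathrm{Gal}(\mathbb K/k((x)))$, which acts on the Berkovich projective line $\mathbb P^1_{\mathrm{an}}=\mathbb P^1_{\mathrm{an}}(\mathbb K)$. Write $\zeta(a,r)$ for the sup norm on the disk of centre $a\in\mathbb K$ and radius $r>0$; the Type II points are the $\zeta(a,|x|^s)$ with $s\in\mathbb Q$, and the Type I points are $\infty$ and the elements of $\hat{\mathbb K}$. For a point $\zeta$ put $\mathfrak m(\zeta)=|G\zeta|\in\{1,2,\dots,\infty\}$, and for a set $U$ put $\mathfrak m(U)=\min_{\xi\in U}\mathfrak m(\xi)$. The generic multiplicity is $\mathfrak g(\zeta)=\mathrm{lcm}(\mathfrak m(\zeta),q)$ if $\zeta=\zeta(a,|x|^{p/q})$ is of Type II with $p/q$ in lowest terms, $\mathfrak g(\zeta)=\mathfrak m(\zeta)$ if $\zeta$ is of Type I, and $\mathfrak g(\zeta)=\infty$ otherwise. A direction at $\zeta$ is a connected component $v$ of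 $\mathbb P^1_{\mathrm{an}}\setminus\{\zeta\}$; at a Type II point it is generic if $\mathfrak m(v)=\mathfrak g(\zeta)$, and special otherwise. A vertex set is a finite set $\Gamma$ of Type II points; the $\Gamma$-domains are the connected components of $\mathbb P^1_{\mathrm{an}}\setminus\Gamma$. For $n\in\mathbb N$ let $\mathcal X_n$ be the set of Type II points $\xi$ with $\mathfrak g(\xi)\le n$. A vertex set $\Gamma\subset\mathcal X_n$ is smoothly $n$-convex if it is $G$-invariant, it is $n$-convex, i.e. $\Gamma=\mathrm{Hull}(\Gamma)\cap\mathcal X_n$ where $\mathrm{Hull}(\Gamma)$ is the convex hull (the smallest connected set containing $\Gamma$), and every $\zeta\in\Gamma$ is flanked, i.e. $\Gamma$ meets each special direction at $\zeta$. A vertex set $\Gamma$ is smooth if it is $G$-invariant and every $\Gamma$-domain $U$ either has exactly one boundary point $\zeta$, with $\mathfrak m(U)=\mathfrak g(\zeta)$, or has exactly two boundary points $\zeta_1,\zeta_2$, with $\mathfrak g(\xi)>\max(\mathfrak g(\zeta_1),\mathfrak g(\zeta_2))$ for all $\xi\in U$. Proposition. For every $n$, every non-empty smoothly $n$-convex vertex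 set $\Gamma$ is smooth. In particular, every $\Gamma$-domain is either a disk whose boundary point $\zeta$ lies in $\Gamma$ and which is a generic direction at $\zeta$, or an annulus with two distinct boundary points $\zeta_1,\zeta_2\in\Gamma$ all of whose points $\xi$ satisfy $\mathfrak g(\xi)>\max(\mathfrak g(\zeta_1),\mathfrak g(\zeta_2))$. -/

import Mathlib

open Polynomial Topology

namespace SkewTree

noncomputable section

section Puiseux

variable (k : Type*) [Field k]

/-- The order embedding `z ↦ z / n` of exponents. -/
def divExp (n : ℕ+) : ℤ →+ ℚ :=
  (AddMonoidHom.mulRight ((n : ℚ)⁻¹)).comp (Int.castAddHom ℚ)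

theorem divExp_apply (n : ℕ+) (z : ℤ) : divExp n z = (z : ℚ) / n := by
  simp [divExp, div_eq_mul_inv]

theorem divExp_le_iff (n : ℕ+) (z w : ℤ) : divExp n z ≤ divExp n w ↔ z ≤ w := by
  have hn : (0 : ℚ) < n := by exact_mod_cast n.pos
  rw [divExp_apply, divExp_apply, div_le_div_iff_of_pos_right hn, Int.cast_le]

theorem divExp_injective (n : ℕ+) : Function.Injective (divExp n) := fun z w h =>
  le_antisymm ((divExp_le_iff n z w).1 h.le) ((divExp_le_iff n w z).1 h.ge)

/-- The embedding `k((t)) → k⟦ℚ⟧`, `t ↦ x^(1/n)`; its range is `k((x^(1/n)))`. -/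
def ramify (n : ℕ+) : LaurentSeries k →+* HahnSeries ℚ k :=
  HahnSeries.embDomainRingHom (divExp n) (divExp_injective n) (divExp_le_iff n)

/-- The field of Puiseux series `⋃ n, k((x^(1/n)))`, inside the Hahn series with exponents in `ℚ`. -/
def puiseuxSubfield : Subfield (HahnSeries ℚ k) :=
  ⨆ n : ℕ+, (ramify k n).fieldRange

/-- The field `𝕂` of Puiseux series in `x` over `k`. -/
abbrev Puiseux : Type _ := ↥(puiseuxSubfield k)

variable {k}

theorem coeff_ramify (n : ℕ+) (L : LaurentSeries k) (z : ℤ) :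
    (ramify k n L).coeff ((z : ℚ) / n) = L.coeff z := by
  rw [← divExp_apply]
  exact HahnSeries.embDomain_mk_coeff (divExp_injective n) (divExp_le_iff n)

theorem coeff_ramify_eq_zero (n : ℕ+) (L : LaurentSeries k) (q : ℚ)
    (hq : ∀ z : ℤ, q ≠ (z : ℚ) / n) : (ramify k n L).coeff q = 0 := by
  refine HahnSeries.embDomain_notin_image_support ?_
  rintro ⟨z, -, hz⟩
  exact hq z (by rw [← hz, ← divExp_apply]; rfl)

theorem ramify_range_le (n m : ℕ+) :
    (ramify k n).fieldRange ≤ (ramify k (n * m)).fieldRange := by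
  rintro _ ⟨L, rfl⟩
  have hn : ((n : ℕ) : ℚ) ≠ 0 := by exact_mod_cast n.ne_zero
  have hm : ((m : ℕ) : ℚ) ≠ 0 := by exact_mod_cast m.ne_zero
  have hm' : (0 : ℤ) < m := by exact_mod_cast m.pos
  let e : ℤ ↪o ℤ := OrderEmbedding.ofMapLEIff (fun z => z * m)
    (fun z w => by simp)
  refine ⟨HahnSeries.embDomain e L, ?_⟩
  ext q
  by_cases hq : ∃ z : ℤ, q = (z : ℚ) / (n * m : ℕ+)
  · obtain ⟨z, rfl⟩ := hq
    rw [coeff_ramify]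
    by_cases hz : ∃ w : ℤ, z = w * m
    · obtain ⟨w, rfl⟩ := hz
      have h1 : (((w * m : ℤ)) : ℚ) / (n * m : ℕ+) = (w : ℚ) / n := by
        push_cast; field_simp
      rw [h1, coeff_ramify]
      exact HahnSeries.embDomain_coeff (f := e) (a := w)
    · rw [HahnSeries.embDomain_notin_image_support, coeff_ramify_eq_zero]
      · intro w hw
        apply hz
        refine ⟨w, ?_⟩
        push_cast at hw
        field_simp at hw
        have hw' : z = m * w := by exact_mod_cast hw
        rw [hw', mul_comm]
      · rintro ⟨w, -, hw⟩
        exact hz ⟨w, hw.symm⟩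
  · push Not at hq
    rw [coeff_ramify_eq_zero _ _ _ hq, coeff_ramify_eq_zero]
    intro w hw
    apply hq (w * m)
    rw [hw]
    push_cast; field_simp

theorem mem_puiseuxSubfield {f : HahnSeries ℚ k} :
    f ∈ puiseuxSubfield k ↔ ∃ (n : ℕ+) (L : LaurentSeries k), ramify k n L = f := by
  have hd : Directed (· ≤ ·) fun n : ℕ+ => (ramify k n).fieldRange := fun n m =>
    ⟨n * m, ramify_range_le n m, by rw [mul_comm]; exact ramify_range_le m n⟩
  rw [puiseuxSubfield, Subfield.mem_iSup_of_directed hd]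
  rfl

/-- `𝕂` as an extension of `k((x))`. -/
instance : Algebra (LaurentSeries k) (Puiseux k) :=
  ((ramify k 1).codRestrict (puiseuxSubfield k)
    fun L => mem_puiseuxSubfield.2 ⟨1, L, rfl⟩).toAlgebra

theorem coe_algebraMap (L : LaurentSeries k) :
    ((algebraMap (LaurentSeries k) (Puiseux k) L : Puiseux k) : HahnSeries ℚ k) = ramify k 1 L :=
  rfl

/-- The `x`-adic absolute value on Hahn series, `|a| = exp (-ord a)`. -/
def hahnAbs : AbsoluteValue (HahnSeries ℚ k) ℝ := by
  classical
  exact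
  { toFun := fun a => if a = 0 then 0 else Real.exp (-(a.order : ℝ))
    map_mul' := fun a b => by
      by_cases ha : a = 0
      · simp [ha]
      by_cases hb : b = 0
      · simp [hb]
      simp only [ha, hb, mul_eq_zero, or_self, if_false]
      rw [HahnSeries.order_mul ha hb, ← Real.exp_add]
      push_cast; ring_nf
    nonneg' := fun a => by
      split_ifs
      · exact le_rfl
      · exact (Real.exp_pos _).le
    eq_zero' := fun a => by
      split_ifs with h
      · simp [h]
      · simp [h, (Real.exp_pos _).ne']
    add_le' := fun a b => by
      by_cases ha : a = 0
      · simp [ha]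
      by_cases hb : b = 0
      · simp [hb]
      by_cases hab : a + b = 0
      · simp only [hab, ha, hb, if_true, if_false]
        positivity
      simp only [ha, hb, hab, if_false]
      have h := HahnSeries.min_order_le_order_add hab
      rcases min_le_iff.1 h with h | h
      · have : Real.exp (-((a + b).order : ℝ)) ≤ Real.exp (-(a.order : ℝ)) := by
          rw [Real.exp_le_exp, neg_le_neg_iff]; exact_mod_cast h
        linarith [Real.exp_pos (-(b.order : ℝ))]
      · have : Real.exp (-((a + b).order : ℝ)) ≤ Real.exp (-(b.order : ℝ)) := by
          rw [Real.exp_le_exp, neg_le_neg_iff]; exact_mod_cast h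
        linarith [Real.exp_pos (-(a.order : ℝ))] }

theorem hahnAbs_of_ne_zero {a : HahnSeries ℚ k} (ha : a ≠ 0) :
    hahnAbs a = Real.exp (-(a.order : ℝ)) :=
  if_neg ha

theorem hahnAbs_le_one_iff {a : HahnSeries ℚ k} :
    hahnAbs a ≤ 1 ↔ ∀ q < 0, a.coeff q = 0 := by
  by_cases ha : a = 0
  · simp [ha]
  rw [hahnAbs_of_ne_zero ha, Real.exp_le_one_iff, neg_nonpos]
  constructor
  · intro h q hq
    by_contra hne
    have h1 : a.order ≤ q := HahnSeries.order_le_of_coeff_ne_zero hne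
    have h2 : (0 : ℚ) ≤ a.order := by exact_mod_cast h
    linarith
  · intro h
    by_contra hlt
    push Not at hlt
    have h2 : a.order < 0 := by exact_mod_cast hlt
    exact HahnSeries.coeff_order_eq_zero.not.2 ha (h _ h2)

theorem hahnAbs_add_le_max (a b : HahnSeries ℚ k) :
    hahnAbs (a + b) ≤ max (hahnAbs a) (hahnAbs b) := by
  by_cases ha : a = 0
  · simp [ha]
  by_cases hb : b = 0
  · simp [hb]
  by_cases hab : a + b = 0
  · rw [hab, map_zero]
    exact le_max_of_le_left (AbsoluteValue.nonneg _ _)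
  rw [hahnAbs_of_ne_zero ha, hahnAbs_of_ne_zero hb, hahnAbs_of_ne_zero hab, le_max_iff,
    Real.exp_le_exp, Real.exp_le_exp, neg_le_neg_iff, neg_le_neg_iff]
  exact_mod_cast min_le_iff.1 (HahnSeries.min_order_le_order_add hab)

/-- `𝕂` with the order of vanishing norm `|a| = exp (-ord a)`. -/
instance : NormedField (Puiseux k) :=
  AbsoluteValue.toNormedField
    (hahnAbs.comp (f := (puiseuxSubfield k).subtype) Subtype.val_injective)

theorem norm_puiseux (a : Puiseux k) : ‖a‖ = hahnAbs (a : HahnSeries ℚ k) := rfl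

instance : IsUltrametricDist (Puiseux k) :=
  IsUltrametricDist.isUltrametricDist_of_forall_norm_add_le_max_norm
    fun a b => hahnAbs_add_le_max (a : HahnSeries ℚ k) b


theorem isIntegral_of_norm_le_one (a : Puiseux k) (ha : ‖a‖ ≤ 1) :
    ((algebraMap (LaurentSeries k) (Puiseux k)).comp
      (HahnSeries.ofPowerSeries ℤ k)).IsIntegralElem a := by
  classical
  set φ : PowerSeries k →+* Puiseux k :=
    (algebraMap (LaurentSeries k) (Puiseux k)).comp (HahnSeries.ofPowerSeries ℤ k) with hφ
  obtain ⟨n, L, hL⟩ := mem_puiseuxSubfield.1 a.2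
  have hn : ((n : ℕ) : ℚ) ≠ 0 := by exact_mod_cast n.ne_zero
  have hneg : ∀ z < 0, L.coeff z = 0 := by
    intro z hz
    rw [← coeff_ramify n L z, hL]
    refine hahnAbs_le_one_iff.1 (by rwa [norm_puiseux] at ha) _ ?_
    exact div_neg_of_neg_of_pos (by exact_mod_cast hz) (by exact_mod_cast n.pos)
  let t : Puiseux k :=
    ⟨ramify k n (HahnSeries.single 1 1), mem_puiseuxSubfield.2 ⟨n, _, rfl⟩⟩
  have htpow : ∀ i : ℕ, ((t ^ i : Puiseux k) : HahnSeries ℚ k) =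
      HahnSeries.single ((i : ℚ) / n) 1 := by
    intro i
    have h1 : ((t ^ i : Puiseux k) : HahnSeries ℚ k) =
        ramify k n (HahnSeries.single (i : ℤ) 1) := by
      push_cast
      rw [← map_pow, HahnSeries.single_pow]
      simp
    rw [h1]
    refine (HahnSeries.embDomain_single).trans ?_
    change HahnSeries.single (divExp n i) 1 = _
    rw [divExp_apply]; rfl
  have ht : φ.IsIntegralElem t := by
    have : t ^ (n : ℕ) = φ PowerSeries.X := by
      apply Subtype.ext
      rw [htpow, hφ, RingHom.comp_apply, coe_algebraMap, HahnSeries.ofPowerSeries_X]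
      rw [div_self hn]
      symm
      refine (HahnSeries.embDomain_single).trans ?_
      change HahnSeries.single (divExp 1 1) 1 = _
      rw [divExp_apply]; simp
    exact ⟨X ^ (n : ℕ) - C PowerSeries.X, monic_X_pow_sub_C _ n.ne_zero, by simp [this]⟩
  have htp : ∀ i : ℕ, φ.IsIntegralElem (t ^ i) := by
    intro i
    induction i with
    | zero => rw [pow_zero]; exact φ.isIntegralElem_one
    | succ i ih => rw [pow_succ]; exact RingHom.IsIntegralElem.mul φ ih ht
  let B : ℕ → PowerSeries k := fun i => PowerSeries.mk fun j => L.coeff ((n : ℤ) * j + i)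
  have key : a = ∑ i ∈ Finset.range n, t ^ i * φ (B i) := by
    apply Subtype.ext
    rw [AddSubmonoidClass.coe_finsetSum]
    ext q
    rw [HahnSeries.coeff_sum]
    have hterm : ∀ i : ℕ, ((t ^ i * φ (B i) : Puiseux k) : HahnSeries ℚ k).coeff q =
        (ramify k 1 (HahnSeries.ofPowerSeries ℤ k (B i))).coeff (q - (i : ℚ) / n) := by
      intro i
      rw [MulMemClass.coe_mul, htpow, HahnSeries.coeff_single_mul, one_mul]
      rfl
    simp only [hterm]
    rw [← hL]
    by_cases hq : ∃ z : ℤ, q = (z : ℚ) / (n : ℕ)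
    · obtain ⟨z, rfl⟩ := hq
      have hnz : (0 : ℤ) < n := by exact_mod_cast n.pos
      obtain ⟨r, hr⟩ := Int.eq_ofNat_of_zero_le (Int.emod_nonneg z hnz.ne')
      have hrn : r < n := by have := Int.emod_lt_of_pos z hnz; omega
      have hzr : z = n * (z / n) + r := by rw [← hr]; exact (Int.mul_ediv_add_emod z n).symm
      rw [coeff_ramify, Finset.sum_eq_single_of_mem r (Finset.mem_range.2 hrn)]
      · have h1 : (z : ℚ) / (n : ℕ) - (r : ℚ) / (n : ℕ) = ((z / n : ℤ) : ℚ) / (1 : ℕ+) := by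
          have : (z : ℚ) = n * ((z / n : ℤ) : ℚ) + r := by exact_mod_cast hzr
          rw [this]; simp; field_simp
          ring
        rw [h1, coeff_ramify]
        by_cases hw : 0 ≤ z / n
        · obtain ⟨w, hw⟩ := Int.eq_ofNat_of_zero_le hw
          rw [hw, HahnSeries.ofPowerSeries_apply_coeff, PowerSeries.coeff_mk, ← hw]
          exact congrArg L.coeff hzr
        · have hz : z < 0 := by
            by_contra hz
            exact hw (Int.ediv_nonneg (not_lt.1 hz) hnz.le)
          rw [hneg z hz]
          symm
          refine HahnSeries.embDomain_notin_image_support ?_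
          rintro ⟨w, -, h⟩
          apply hw
          rw [← h]
          exact Int.natCast_nonneg w
      · intro i hi hir
        apply coeff_ramify_eq_zero
        intro w hw
        apply hir
        have h2 : (z : ℚ) = n * w + i := by
          simp at hw; field_simp at hw; linarith
        have h3 : z = n * w + i := by exact_mod_cast h2
        have h4 : z % n = i := by
          rw [h3, Int.mul_add_emod_self_left]
          exact Int.emod_eq_of_lt (by positivity) (by exact_mod_cast Finset.mem_range.1 hi)
        omega
    · push Not at hq
      rw [coeff_ramify_eq_zero n L q hq]
      symm
      apply Finset.sum_eq_zero
      intro i _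
      apply coeff_ramify_eq_zero
      intro w hw
      apply hq (n * w + i)
      simp at hw
      push_cast
      field_simp at hw ⊢
      linarith
  rw [key]
  refine Finset.sum_induction _ φ.IsIntegralElem (fun _ _ => RingHom.IsIntegralElem.add φ) φ.isIntegralElem_zero ?_
  intro i _
  exact RingHom.IsIntegralElem.mul φ (htp i) φ.isIntegralElem_map

theorem norm_algebraMap_powerSeries_le (f : PowerSeries k) :
    ‖(algebraMap (LaurentSeries k) (Puiseux k)) (HahnSeries.ofPowerSeries ℤ k f)‖ ≤ 1 := by
  rw [norm_puiseux, coe_algebraMap, hahnAbs_le_one_iff]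
  intro q hq
  by_cases h : ∃ z : ℤ, q = (z : ℚ) / (1 : ℕ+)
  · obtain ⟨z, rfl⟩ := h
    rw [coeff_ramify]
    refine HahnSeries.embDomain_notin_image_support ?_
    rintro ⟨w, -, h⟩
    have hz : z < 0 := by simpa using hq
    rw [← h] at hz
    exact absurd hz (not_lt.2 (Int.natCast_nonneg w))
  · push Not at h
    exact coeff_ramify_eq_zero _ _ _ h

theorem norm_le_one_of_isIntegral (a : Puiseux k)
    (ha : ((algebraMap (LaurentSeries k) (Puiseux k)).comp
      (HahnSeries.ofPowerSeries ℤ k)).IsIntegralElem a) : ‖a‖ ≤ 1 := by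
  obtain ⟨p, hp, h0⟩ := ha
  by_contra hlt
  push Not at hlt
  have hd : p.natDegree ≠ 0 := by
    intro hd
    rw [hp.natDegree_eq_zero.1 hd] at h0
    simp at h0
  rw [eval₂_eq_sum_range, Finset.sum_range_succ, hp.coeff_natDegree, map_one, one_mul] at h0
  have h1 := congrArg norm (eq_neg_of_add_eq_zero_right h0)
  rw [norm_neg, norm_pow] at h1
  have h2 : ‖a‖ ^ p.natDegree ≤ ‖a‖ ^ (p.natDegree - 1) := by
    rw [h1]
    refine IsUltrametricDist.norm_sum_le_of_forall_le_of_nonneg (by positivity) ?_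
    intro i hi
    rw [norm_mul, norm_pow]
    have hi' : i ≤ p.natDegree - 1 := by have := Finset.mem_range.1 hi; omega
    calc _ ≤ 1 * ‖a‖ ^ (p.natDegree - 1) := by
          gcongr
          · exact norm_algebraMap_powerSeries_le _
          · exact hlt.le
      _ = _ := one_mul _
  exact absurd h2 (not_le.2 (pow_lt_pow_right₀ hlt (by omega)))

/-- The absolute Galois group `G` of `k((x))`. -/
abbrev GalGroup (k : Type*) [Field k] : Type _ := Puiseux k ≃ₐ[LaurentSeries k] Puiseux k

theorem norm_gal_le_one (g : GalGroup k) (a : Puiseux k) (ha : ‖a‖ ≤ 1) : ‖g a‖ ≤ 1 := by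
  apply norm_le_one_of_isIntegral
  obtain ⟨p, hp, h0⟩ := isIntegral_of_norm_le_one a ha
  refine ⟨p, hp, ?_⟩
  have h1 := congrArg (g : Puiseux k →+* Puiseux k) h0
  rw [hom_eval₂, map_zero] at h1
  have h2 : (g : Puiseux k →+* Puiseux k).comp ((algebraMap (LaurentSeries k) (Puiseux k)).comp
      (HahnSeries.ofPowerSeries ℤ k)) = (algebraMap (LaurentSeries k) (Puiseux k)).comp
      (HahnSeries.ofPowerSeries ℤ k) := RingHom.ext fun f => g.commutes _
  rwa [h2] at h1

theorem norm_gal_le (g : GalGroup k) (a : Puiseux k) : ‖g a‖ ≤ ‖a‖ := by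
  by_cases ha : a = 0
  · simp [ha]
  have hq : ((a : HahnSeries ℚ k).order).den ≠ 0 := Rat.den_nz _
  have ha' : (a : HahnSeries ℚ k) ≠ 0 := fun h => ha (Subtype.ext h)
  set q := (a : HahnSeries ℚ k).order with hqdef
  let L : LaurentSeries k := HahnSeries.single q.num 1
  have hL : ‖algebraMap (LaurentSeries k) (Puiseux k) L‖ = ‖a‖ ^ q.den := by
    have h1 : ramify k 1 L = HahnSeries.single (q.num : ℚ) 1 := by
      refine (HahnSeries.embDomain_single).trans ?_
      change HahnSeries.single (divExp 1 q.num) 1 = _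
      rw [divExp_apply]; simp
    rw [norm_puiseux, norm_puiseux, coe_algebraMap, h1,
      hahnAbs_of_ne_zero (HahnSeries.single_ne_zero one_ne_zero), hahnAbs_of_ne_zero ha',
      HahnSeries.order_single one_ne_zero, ← Real.exp_nat_mul, ← hqdef]
    congr 1
    have : (q : ℝ) * q.den = q.num := by exact_mod_cast Rat.mul_den_eq_num q
    push_cast
    linarith
  set y := algebraMap (LaurentSeries k) (Puiseux k) L with hy
  have hna : ‖a‖ ≠ 0 := norm_ne_zero_iff.2 ha
  have hy0 : ‖y‖ ≠ 0 := by rw [hL]; exact pow_ne_zero _ hna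
  have hu : ‖g (a ^ q.den / y)‖ ≤ 1 := by
    apply norm_gal_le_one
    rw [norm_div, norm_pow, hL, div_self (pow_ne_zero _ hna)]
  rw [map_div₀, map_pow, norm_div, norm_pow, hy, g.commutes, ← hy, hL,
    div_le_one (by positivity)] at hu
  exact le_of_pow_le_pow_left₀ hq (norm_nonneg _) hu

/-- The Galois group acts on `𝕂` by isometries. -/
theorem norm_gal (g : GalGroup k) (a : Puiseux k) : ‖g a‖ = ‖a‖ := by
  refine le_antisymm (norm_gal_le g a) ?_
  have := norm_gal_le g⁻¹ (g a)
  rwa [← AlgEquiv.mul_apply, inv_mul_cancel, AlgEquiv.one_apply] at this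

end Puiseux

section Berkovich

variable (K : Type*) [NormedField K]

/-- The Berkovich affine line: multiplicative seminorms on `K[y]` extending the norm of `K`. -/
@[ext]
structure BerkovichA1 where
  toSeminorm : MulRingSeminorm K[X]
  map_C' : ∀ a : K, toSeminorm (C a) = ‖a‖

instance : CoeFun (BerkovichA1 K) fun _ => K[X] → ℝ := ⟨fun ζ => ζ.toSeminorm⟩

/-- The topology of pointwise convergence: the coarsest one making every `ζ ↦ ‖f‖_ζ` continuous. -/
instance : TopologicalSpace (BerkovichA1 K) :=
  TopologicalSpace.induced (fun ζ (f : K[X]) => ζ f) inferInstance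

/-- The Berkovich projective line, as the one-point compactification of the affine line. -/
abbrev BerkovichP1 : Type _ := OnePoint (BerkovichA1 K)

variable {K}

/-- Type I points: `∞` and the evaluations `f ↦ |f(a)|` at points `a` of the completion of `K`. -/
def IsTypeI (ζ : BerkovichP1 K) : Prop :=
  ζ = OnePoint.infty ∨ ∃ (ξ : BerkovichA1 K) (a : UniformSpace.Completion K), ζ = ξ ∧
    ∀ f : K[X], ξ f = ‖f.eval₂ (UniformSpace.Completion.coeRingHom : K →+* _) a‖

/-- The point `ζ(a, r)`, i.e. the sup norm on the disk of centre `a` and radius `r`: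
`‖∑ cᵢ (y - a)ⁱ‖ = max |cᵢ| rⁱ`. -/
def diskPoint [IsUltrametricDist K] (a : K) (r : ℝ) (hr : 0 < r) : BerkovichA1 K where
  toSeminorm :=
    { toFun := fun f => (taylor a f).gaussNorm (NormedField.toAbsoluteValue K) r
      map_zero' := by simp
      add_le' := fun f g => by
        have hna : IsNonarchimedean (NormedField.toAbsoluteValue K) :=
          fun x y => IsUltrametricDist.norm_add_le_max x y
        rw [map_add]
        refine (isNonarchimedean_gaussNorm _ hna hr.le _ _).trans ?_
        exact max_le_add_of_nonneg (gaussNorm_nonneg _ _ hr.le) (gaussNorm_nonneg _ _ hr.le)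
      neg' := fun f => by
        rw [map_neg]
        simp only [gaussNorm, support_neg, coeff_neg, AbsoluteValue.map_neg]
      map_one' := by
        rw [taylor_one, gaussNorm_C, map_one]
      map_mul' := fun f g => by
        have hna : IsNonarchimedean (NormedField.toAbsoluteValue K) :=
          fun x y => IsUltrametricDist.norm_add_le_max x y
        rw [taylor_mul, gaussNorm_mul hna hr] }
  map_C' := fun b => by
    change (taylor a (C b)).gaussNorm (NormedField.toAbsoluteValue K) r = ‖b‖
    rw [taylor_C, gaussNorm_C]
    rfl

end Berkovich

section Tree

variable {T : Type*} [TopologicalSpace T]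

/-- The set `S(Γ)` of `Γ`-domains: the connected components of the complement of `Γ`. -/
def domains (Γ : Set T) : Set (Set T) :=
  {U | ∃ ξ ∈ Γᶜ, U = connectedComponentIn Γᶜ ξ}

/-- The directions at `ζ`: the connected components of the complement of `ζ`. -/
def directions (ζ : T) : Set (Set T) := domains {ζ}

/-- The convex hull of `Γ` in a uniquely arcwise connected tree such as the Berkovich projective
line: the smallest connected set containing `Γ`, equivalently the union of all segments `[ζ, ξ]` with `ζ, ξ ∈ Γ`. -/
def hull (Γ : Set T) : Set T := ⋂₀ {S | IsPreconnected S ∧ Γ ⊆ S}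

end Tree

section Multiplicity

variable {k : Type*} [Field k]

/-- The Galois action on the affine line, `‖f‖_{g ζ} = ‖g⁻¹ f‖_ζ`. -/
instance : MulAction (GalGroup k) (BerkovichA1 (Puiseux k)) where
  smul g ζ :=
    { toSeminorm :=
        { toFun := fun f => ζ (f.map (g⁻¹ : GalGroup k).toRingHom)
          map_zero' := by rw [Polynomial.map_zero, map_zero]
          add_le' := fun f h => by rw [Polynomial.map_add]; exact map_add_le_add _ _ _
          neg' := fun f => by rw [Polynomial.map_neg, map_neg_eq_map]
          map_one' := by rw [Polynomial.map_one, map_one]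
          map_mul' := fun f h => by rw [Polynomial.map_mul, map_mul] }
      map_C' := fun a => by
        change ζ ((C a).map (g⁻¹ : GalGroup k).toRingHom) = ‖a‖
        rw [map_C, ζ.map_C']
        exact norm_gal _ a }
  one_smul ζ := by
    apply BerkovichA1.ext
    apply DFunLike.ext
    intro f
    change ζ (f.map ((1 : GalGroup k)⁻¹).toRingHom) = ζ f
    rw [inv_one]
    exact congrArg _ Polynomial.map_id
  mul_smul g h ζ := by
    apply BerkovichA1.ext
    apply DFunLike.ext
    intro f
    change ζ (f.map ((g * h)⁻¹ : GalGroup k).toRingHom) =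
      ζ ((f.map (g⁻¹ : GalGroup k).toRingHom).map (h⁻¹ : GalGroup k).toRingHom)
    rw [Polynomial.map_map, mul_inv_rev]
    rfl

/-- The Galois action on the projective line; it fixes `∞`. -/
instance : MulAction (GalGroup k) (BerkovichP1 (Puiseux k)) where
  smul g := OnePoint.map (g • ·)
  one_smul ζ := by
    induction ζ using OnePoint.rec with
    | infty => rfl
    | coe ζ => exact congrArg OnePoint.some (one_smul _ ζ)
  mul_smul g h ζ := by
    induction ζ using OnePoint.rec with
    | infty => rfl
    | coe ζ => exact congrArg OnePoint.some (mul_smul g h ζ)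

theorem gal_smul_apply (g : GalGroup k) (ζ : BerkovichA1 (Puiseux k)) (f : (Puiseux k)[X]) :
    (g • ζ) f = ζ (f.map (g⁻¹ : GalGroup k).toRingHom) := rfl

theorem gal_smul_infty (g : GalGroup k) :
    g • (OnePoint.infty : BerkovichP1 (Puiseux k)) = OnePoint.infty := rfl

theorem gal_smul_coe (g : GalGroup k) (ζ : BerkovichA1 (Puiseux k)) :
    g • (ζ : BerkovichP1 (Puiseux k)) = ((g • ζ : BerkovichA1 (Puiseux k)) : BerkovichP1 _) := rfl

/-- The point `ζ(a, |x|^s)`. -/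
def zeta (a : Puiseux k) (s : ℚ) : BerkovichP1 (Puiseux k) :=
  ((diskPoint a (Real.exp (-(s : ℝ))) (Real.exp_pos _) : BerkovichA1 (Puiseux k)) : BerkovichP1 _)

/-- Type II points: `ζ(a, r)` with `a ∈ 𝕂` and `r` in the value group `|𝕂ˣ| = |x|^ℚ`. -/
def IsTypeII (ζ : BerkovichP1 (Puiseux k)) : Prop :=
  ∃ (a : Puiseux k) (s : ℚ), ζ = zeta a s

/-- The exponent `s` of a Type II point `ζ(a, |x|^s)`; it is unique, see `exponent_zeta`. -/
def IsTypeII.exponent {ζ : BerkovichP1 (Puiseux k)} (h : IsTypeII ζ) : ℚ :=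
  h.choose_spec.choose

theorem diskPoint_X_sub_C (a b : Puiseux k) (r : ℝ) (hr : 0 < r) :
    r ≤ diskPoint a r hr (X - C b) := by
  have h := le_gaussNorm (NormedField.toAbsoluteValue (Puiseux k)) (taylor a (X - C b)) hr.le 1
  refine le_trans (le_of_eq ?_) h
  rw [map_sub, taylor_X, taylor_C]
  simp [coeff_X]

theorem diskPoint_X_sub_C_self (a : Puiseux k) (r : ℝ) (hr : 0 < r) :
    diskPoint a r hr (X - C a) = r := by
  change (taylor a (X - C a)).gaussNorm (NormedField.toAbsoluteValue (Puiseux k)) r = r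
  rw [map_sub, taylor_X, taylor_C, add_sub_cancel_right, ← monomial_one_one_eq_X,
    gaussNorm_monomial]
  simp

theorem zeta_exponent_le {a b : Puiseux k} {s t : ℚ} (h : zeta a s = zeta b t) : s ≤ t := by
  have h1 := OnePoint.coe_injective h
  have h2 := diskPoint_X_sub_C b a (Real.exp (-(t : ℝ))) (Real.exp_pos _)
  rw [← h1, diskPoint_X_sub_C_self, Real.exp_le_exp, neg_le_neg_iff] at h2
  exact_mod_cast h2

theorem exponent_zeta (a : Puiseux k) (s : ℚ) (h : IsTypeII (zeta a s)) : h.exponent = s := by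
  have h1 := h.choose_spec.choose_spec
  exact le_antisymm (zeta_exponent_le h1.symm) (zeta_exponent_le h1)

variable (k) in
/-- Points of the Berkovich projective line over the Puiseux series. -/
abbrev Pt : Type _ := BerkovichP1 (Puiseux k)

/-- The multiplicity `𝔪(ζ)`: the size of the Galois orbit. -/
def mult (ζ : Pt k) : ℕ∞ := (MulAction.orbit (GalGroup k) ζ).encard

/-- `𝔪(U) = min {𝔪(ξ) | ξ ∈ U}`. -/
def multSet (U : Set (Pt k)) : ℕ∞ := ⨅ ξ ∈ U, mult ξ

open Classical in
/-- The generic multiplicity `𝔤(ζ)`: `LCM (𝔪(ζ), q)` for `ζ = ζ(a, |x|^(p/q))` of Type II with `p/q`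
in lowest terms (then `𝔪(ζ)` is finite), `𝔪(ζ)` at Type I and `∞` at Types III and IV. -/
def genMult (ζ : Pt k) : ℕ∞ :=
  if h : IsTypeII ζ then (Nat.lcm (mult ζ).toNat h.exponent.den : ℕ)
  else if IsTypeI ζ then mult ζ
  else ⊤

theorem genMult_zeta (a : Puiseux k) (s : ℚ) :
    genMult (zeta a s) = (Nat.lcm (mult (zeta a s)).toNat s.den : ℕ) := by
  have h : IsTypeII (zeta a s) := ⟨a, s, rfl⟩
  rw [genMult, dif_pos h, exponent_zeta]

/-- A direction `v` at `ζ` is generic iff `𝔪(v) = 𝔤(ζ)`. -/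
def IsGenericDirection (ζ : Pt k) (v : Set (Pt k)) : Prop :=
  v ∈ directions ζ ∧ multSet v = genMult ζ

/-- A direction `v` at `ζ` is special iff it is not generic. -/
def IsSpecialDirection (ζ : Pt k) (v : Set (Pt k)) : Prop :=
  v ∈ directions ζ ∧ multSet v ≠ genMult ζ

/-- A vertex set is a finite set of Type II points. -/
def IsVertexSet (Γ : Set (Pt k)) : Prop := Γ.Finite ∧ ∀ ζ ∈ Γ, IsTypeII ζ

/-- `Γ` is geometric iff it is Galois-invariant. -/
def IsGeometric (Γ : Set (Pt k)) : Prop := ∀ (g : GalGroup k), ∀ ζ ∈ Γ, g • ζ ∈ Γ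

/-- `ζ` is flanked by `Γ` iff `Γ` meets each special direction at `ζ`. -/
def IsFlanked (Γ : Set (Pt k)) (ζ : Pt k) : Prop :=
  ∀ v, IsSpecialDirection ζ v → (Γ ∩ v).Nonempty

variable (k) in
/-- The set `𝒳ₙ` of Type II points of generic multiplicity at most `n`. -/
def genSet (n : ℕ) : Set (Pt k) := {ξ | IsTypeII ξ ∧ genMult ξ ≤ n}

/-- `Γ ⊆ 𝒳ₙ` is `n`-convex iff it equals its `n`-convex hull `Hull(Γ) ∩ 𝒳ₙ`. -/
def IsNConvex (n : ℕ) (Γ : Set (Pt k)) : Prop :=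
  Γ ⊆ genSet k n ∧ Γ = hull Γ ∩ genSet k n

/-- Smoothly `n`-convex vertex sets. -/
structure IsSmoothlyNConvex (n : ℕ) (Γ : Set (Pt k)) : Prop where
  isVertexSet : IsVertexSet Γ
  isGeometric : IsGeometric Γ
  isNConvex : IsNConvex n Γ
  isFlanked : ∀ ζ ∈ Γ, IsFlanked Γ ζ

/-- Smooth vertex sets. A `Γ`-domain is a disk if it has exactly one boundary point and an annulus
if it has exactly two. -/
structure IsSmooth (Γ : Set (Pt k)) : Prop where
  isVertexSet : IsVertexSet Γ
  isGeometric : IsGeometric Γ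
  disk_or_annulus : ∀ U ∈ domains Γ,
    (∃ ζ, frontier U = {ζ} ∧ multSet U = genMult ζ) ∨
    (∃ ζ₁ ζ₂, ζ₁ ≠ ζ₂ ∧ frontier U = {ζ₁, ζ₂} ∧
      ∀ ξ ∈ U, max (genMult ζ₁) (genMult ζ₂) < genMult ξ)

end Multiplicity

end

end SkewTree

open Polynomial Topology

namespace SkewTree

noncomputable section

/-! ### The Newton-Puiseux theorem through the spectral norm. -/

section NewtonPuiseux

/-! Since `Γ` is finite, a domain `U` is open and its boundary lies in `Γ`; since the projective
line is connected and `Γ` is non-empty, this boundary is non-empty. If it is a single point `ζ`,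
then `U` is a direction at `ζ` that misses `Γ`, and flankedness makes it generic.

Suppose there are two boundary points `ζ₁ ≠ ζ₂`, and let `ξ` be any further point of `U` or of its
boundary. The segments between these three points have a common point, the median `η`
(`exists_isDiskPoint_mem_hull`), and it lies in `U`, hence not in `Γ`. As `η ∈ Hull(Γ)`, convexity
gives `𝔤(η) > n` when `η` is of Type II; any other disk point has `𝔤 = ∞`. So the case `ξ = η` is
settled. Otherwise three directions at `η` are occupied, at least two of them by balls about some
`b`, `c` with `|b - c|` equal to the radius `|x|^s` of `η`. So `x^s` occurs in `b` or in `c`, and by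
`genMult_zeta_le_mult` every point of that ball has multiplicity at least `𝔤(η)`: its stabilizer
fixes `η` and the coefficients at `x^s`, so its index is divisible by both `𝔪(η)` and the
denominator of `s`. Thus one of `ζ₁`, `ζ₂`, `ξ` has multiplicity above `n`, and it can only be `ξ`.
Hence `𝔤(ξ) > n`, which gives the annulus inequality in `U` and excludes a third boundary point.

Algebraic closedness of `𝕂` makes a seminorm determined by its values on the linear polynomials `X -
a`, so that the tree is handled through the functions `ptDist`; it also supplies enough Galois
automorphisms. -/

theorem norm_multiset_sum_lt {L : Type*} [NormedField L] [IsUltrametricDist L] {ε : ℝ}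
    (hε : 0 < ε) (s : Multiset L) (h : ∀ a ∈ s, ‖a‖ < ε) : ‖s.sum‖ < ε := by
  induction s using Multiset.induction with
  | empty => simpa
  | cons a s ih =>
    rw [Multiset.sum_cons]
    refine (IsUltrametricDist.norm_add_le_max _ _).trans_lt (max_lt (h a (by simp)) ?_)
    exact ih fun b hb => h b (by simp [hb])

/-- An algebraic extension with tame Galois-invariant norm is trivial as soon as every nonzero
element is approximated by the base field to better than its own size. -/
theorem algebraMap_surjective_of_norm_approx {K L : Type*} [Field K] [NormedField L]
    [IsUltrametricDist L] [Algebra K L] [Normal K L]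
    (hnat : ∀ n : ℕ, n ≠ 0 → ‖(n : L)‖ = 1)
    (hσ : ∀ (σ : L ≃ₐ[K] L) (x : L), ‖σ x‖ = ‖x‖)
    (H : ∀ α : L, α ≠ 0 → ∃ c : K, ‖α - algebraMap K L c‖ < ‖α‖) :
    Function.Surjective (algebraMap K L) := by
  intro α
  have hint : IsIntegral K α := Algebra.IsIntegral.isIntegral α
  have hsplit : ((minpoly K α).map (algebraMap K L)).Splits := Normal.splits inferInstance α
  set s := (minpoly K α).aroots L with hs
  set d := (minpoly K α).natDegree with hd
  have hd0 : d ≠ 0 := (minpoly.natDegree_pos hint).ne'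
  have hdL : (d : L) ≠ 0 := fun h => by
    have := hnat d hd0
    rw [h, norm_zero] at this
    exact zero_ne_one this
  have hcard : Multiset.card s = d := by
    rw [hs, aroots, ← hsplit.natDegree_eq_card_roots, natDegree_map]
  have hsum : s.sum = algebraMap K L (-(minpoly K α).nextCoeff) := by
    have h1 := hsplit.nextCoeff_eq_neg_sum_roots_mul_leadingCoeff
    rw [((minpoly.monic hint).map _).leadingCoeff,
      nextCoeff_map (algebraMap K L).injective] at h1
    rw [map_neg, h1, hs, aroots]
    ring
  set τ : K := -(minpoly K α).nextCoeff / d with hτ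
  have hτL : (d : L) * algebraMap K L τ = s.sum := by
    rw [hsum, hτ, map_div₀, map_natCast]
    field_simp
  by_contra hα
  have hβ : α - algebraMap K L τ ≠ 0 := fun h => hα ⟨τ, (sub_eq_zero.1 h).symm⟩
  obtain ⟨c, hc⟩ := H _ hβ
  have hconj : ∀ a ∈ s, ‖a - algebraMap K L τ - algebraMap K L c‖ < ‖α - algebraMap K L τ‖ := by
    intro a ha
    have ha' : IsConjRoot K α a := (isConjRoot_iff_mem_minpoly_aroots hint).2 ha
    obtain ⟨σ, rfl⟩ := ha'.symm.exists_algEquiv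
    have : σ α - algebraMap K L τ - algebraMap K L c =
        σ (α - algebraMap K L τ - algebraMap K L c) := by simp
    rwa [this, hσ]
  have h1 := norm_multiset_sum_lt (norm_pos_iff.2 hβ)
    (s.map fun a => a - algebraMap K L τ - algebraMap K L c) (by simpa using hconj)
  have h2 : (s.map fun a => a - algebraMap K L τ - algebraMap K L c).sum =
      -((d : L) * algebraMap K L c) := by
    simp only [Multiset.sum_map_sub, Multiset.map_id', Multiset.map_const',
      Multiset.sum_replicate, hcard, nsmul_eq_mul, hτL]
    ring
  -- The conjugates of `α - τ` sum to zero, so only `-d c` survives and `‖c‖ < ‖α - τ‖`. This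
  -- contradicts `‖α - τ - c‖ < ‖α - τ‖`.
  rw [h2, norm_neg, norm_mul, hnat d hd0, one_mul] at h1
  have h3 := IsUltrametricDist.norm_add_le_max (α - algebraMap K L τ - algebraMap K L c)
    (algebraMap K L c)
  rw [sub_add_cancel] at h3
  exact absurd h3 (not_le.2 (max_lt hc h1))

variable {k : Type*} [Field k]

theorem hahnAbs_le_exp_iff {a : HahnSeries ℚ k} {s : ℚ} :
    hahnAbs a ≤ Real.exp (-(s : ℝ)) ↔ ∀ q < s, a.coeff q = 0 := by
  by_cases ha : a = 0
  · simp [ha, (Real.exp_pos _).le]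
  rw [hahnAbs_of_ne_zero ha, Real.exp_le_exp, neg_le_neg_iff]
  norm_cast
  constructor
  · intro h q hq
    by_contra hne
    exact absurd (HahnSeries.order_le_of_coeff_ne_zero hne) (not_le.2 (hq.trans_le h))
  · intro h
    by_contra hlt
    exact HahnSeries.coeff_order_eq_zero.not.2 ha (h _ (not_le.1 hlt))

/-- The strict inequality also controls the coefficient at `s` itself, which is what the Galois
character on that coefficient needs. -/
theorem hahnAbs_lt_exp_iff {a : HahnSeries ℚ k} {s : ℚ} :
    hahnAbs a < Real.exp (-(s : ℝ)) ↔ ∀ q ≤ s, a.coeff q = 0 := by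
  by_cases ha : a = 0
  · simp [ha, Real.exp_pos]
  rw [hahnAbs_of_ne_zero ha, Real.exp_lt_exp, neg_lt_neg_iff]
  norm_cast
  constructor
  · intro h q hq
    by_contra hne
    exact absurd (HahnSeries.order_le_of_coeff_ne_zero hne) (not_le.2 (hq.trans_lt h))
  · intro h
    by_contra hlt
    exact HahnSeries.coeff_order_eq_zero.not.2 ha (h _ (not_lt.1 hlt))

theorem ramify_single (n : ℕ+) (z : ℤ) (c : k) :
    ramify k n (HahnSeries.single z c) = HahnSeries.single ((z : ℚ) / n) c := by
  refine (HahnSeries.embDomain_single).trans ?_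
  change HahnSeries.single (divExp n z) c = _
  rw [divExp_apply]

/-- The monomial `c x ^ s`. -/
def mono (s : ℚ) (c : k) : Puiseux k :=
  ⟨HahnSeries.single s c, mem_puiseuxSubfield.2 ⟨s.den.toPNat s.pos, HahnSeries.single s.num c, by
    rw [ramify_single]
    exact congrArg (HahnSeries.single · c) (Rat.num_div_den s)⟩⟩

theorem coe_mono (s : ℚ) (c : k) : (mono s c : HahnSeries ℚ k) = HahnSeries.single s c := rfl

theorem mono_mul (s t : ℚ) (c d : k) : mono s c * mono t d = mono (s + t) (c * d) :=
  Subtype.ext (HahnSeries.single_mul_single ..)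

theorem mono_pow (s : ℚ) (c : k) (n : ℕ) : mono s c ^ n = mono (n * s) (c ^ n) := by
  apply Subtype.ext
  rw [SubmonoidClass.coe_pow, coe_mono, coe_mono, HahnSeries.single_pow, nsmul_eq_mul]

theorem mono_eq_zero_iff {s : ℚ} {c : k} : mono s c = 0 ↔ c = 0 := by
  rw [← HahnSeries.single_eq_zero_iff (a := s) (r := c), ← coe_mono]
  exact ⟨fun h => by rw [h]; rfl, fun h => Subtype.ext h⟩

theorem norm_mono {s : ℚ} {c : k} (hc : c ≠ 0) : ‖mono s c‖ = Real.exp (-(s : ℝ)) := by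
  rw [norm_puiseux, coe_mono, hahnAbs_of_ne_zero (HahnSeries.single_ne_zero hc),
    HahnSeries.order_single hc]

theorem mono_intCast (z : ℤ) (c : k) :
    mono (z : ℚ) c = algebraMap (LaurentSeries k) (Puiseux k) (HahnSeries.single z c) := by
  apply Subtype.ext
  rw [coe_algebraMap, ramify_single, coe_mono]
  simp

/-- The absolute value of `k((x))`. -/
abbrev laurentNormedField (k : Type*) [Field k] : NormedField (LaurentSeries k) :=
  AbsoluteValue.toNormedField (hahnAbs.comp (f := ramify k 1) (ramify k 1).injective)

theorem norm_laurent (L : LaurentSeries k) :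
    letI := laurentNormedField k
    ‖L‖ = ‖algebraMap (LaurentSeries k) (Puiseux k) L‖ := rfl

theorem norm_laurent_le_exp_iff (L : LaurentSeries k) (M : ℤ) :
    letI := laurentNormedField k
    ‖L‖ ≤ Real.exp (-(M : ℝ)) ↔ ∀ z < M, L.coeff z = 0 := by
  let := laurentNormedField k
  have h := hahnAbs_le_exp_iff (a := ramify k 1 L) (s := M)
  have h0 : ‖L‖ = hahnAbs (ramify k 1 L) := rfl
  rw [h0]
  simp only [Rat.cast_intCast] at h
  rw [h]
  constructor
  · intro H z hz
    rw [← coeff_ramify 1]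
    exact H _ (by simpa using hz)
  · intro H q hq
    by_cases hq' : ∃ z : ℤ, q = (z : ℚ) / (1 : ℕ+)
    · obtain ⟨z, rfl⟩ := hq'
      rw [coeff_ramify]
      exact H _ (by simpa using hq)
    · push Not at hq'
      exact coeff_ramify_eq_zero _ _ _ hq'

theorem isUltrametricDist_laurent :
    letI := laurentNormedField k
    IsUltrametricDist (LaurentSeries k) := by
  let := laurentNormedField k
  refine IsUltrametricDist.isUltrametricDist_of_forall_norm_add_le_max_norm fun a b => ?_
  have := hahnAbs_add_le_max (ramify k 1 a) (ramify k 1 b)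
  rwa [← map_add] at this

theorem exists_exp_neg_intCast_lt {ε : ℝ} (hε : 0 < ε) : ∃ M : ℤ, Real.exp (-(M : ℝ)) < ε := by
  obtain ⟨M, hM⟩ := exists_nat_gt (-Real.log ε)
  refine ⟨M, ?_⟩
  rw [← Real.lt_log_iff_exp_lt hε]
  push_cast
  linarith

/-- In a Cauchy sequence each coefficient is eventually constant, and the limit is read off
coefficientwise. Completeness is what makes the spectral norm multiplicative on algebraic
extensions. -/
theorem completeSpace_laurent :
    @CompleteSpace (LaurentSeries k)
      (laurentNormedField k).toMetricSpace.toPseudoMetricSpace.toUniformSpace := by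
  let := laurentNormedField k
  refine @Metric.complete_of_cauchySeq_tendsto (LaurentSeries k) _ fun u hu => ?_
  have hu' : ∀ M : ℤ, ∃ N : ℕ, ∀ m ≥ N, ∀ n ≥ N, ∀ z < M, (u m).coeff z = (u n).coeff z := by
    intro M
    obtain ⟨N, hN⟩ := Metric.cauchySeq_iff.1 hu _ (Real.exp_pos (-(M : ℝ)))
    refine ⟨N, fun m hm n hn z hz => ?_⟩
    have h := hN m hm n hn
    rw [dist_eq_norm] at h
    have := (norm_laurent_le_exp_iff _ _).1 h.le z hz
    rwa [HahnSeries.coeff_sub, sub_eq_zero] at this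
  choose N hN using hu'
  -- The coefficient at `z` is frozen from index `N (z + 1)` on, because agreement at level `M`
  -- covers only `z < M`.
  have hc : ∀ M, ∀ m ≥ N M, ∀ z < M, (u m).coeff z = (u (N (z + 1))).coeff z := by
    intro M m hm z hz
    rw [hN M m hm (max m (N (z + 1))) (hm.le.trans (le_max_left _ _)) z hz]
    exact hN (z + 1) _ (le_max_right _ _) _ le_rfl z (by omega)
  have hb : BddBelow (Function.support fun z : ℤ => (u (N (z + 1))).coeff z) := by
    refine ⟨min 0 (u (N 0)).order, fun z hz => ?_⟩
    by_contra hlt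
    rw [not_le, lt_min_iff] at hlt
    apply hz
    change (u (N (z + 1))).coeff z = 0
    rw [← hc 0 _ le_rfl z hlt.1]
    exact HahnSeries.coeff_eq_zero_of_lt_order hlt.2
  refine ⟨HahnSeries.ofSuppBddBelow _ hb, ?_⟩
  rw [Metric.tendsto_atTop]
  intro ε hε
  obtain ⟨M, hM⟩ := exists_exp_neg_intCast_lt hε
  refine ⟨N M, fun m hm => ?_⟩
  rw [dist_eq_norm]
  refine lt_of_le_of_lt ((norm_laurent_le_exp_iff _ M).2 fun z hz => ?_) hM
  rw [HahnSeries.coeff_sub, hc M m hm z hz]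
  exact sub_self _

/-- `k((x))` as a complete nonarchimedean field. -/
abbrev laurentNontriviallyNormedField (k : Type*) [Field k] :
    NontriviallyNormedField (LaurentSeries k) where
  __ := laurentNormedField k
  non_trivial := by
    let := laurentNormedField k
    refine ⟨HahnSeries.single (-1) 1, ?_⟩
    rw [norm_laurent, ← mono_intCast, norm_mono one_ne_zero]
    simp

instance isAlgebraic_puiseux : Algebra.IsAlgebraic (LaurentSeries k) (Puiseux k) := by
  have hle : ∀ a : Puiseux k, ‖a‖ ≤ 1 → IsIntegral (LaurentSeries k) a := by
    intro a ha
    obtain ⟨p, hp, h⟩ := isIntegral_of_norm_le_one a ha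
    exact ⟨p.map (HahnSeries.ofPowerSeries ℤ k), hp.map _, by rwa [eval₂_map]⟩
  refine ⟨fun a => IsIntegral.isAlgebraic ?_⟩
  rcases le_total ‖a‖ 1 with h | h
  · exact hle a h
  · rw [← inv_inv a]
    refine (hle a⁻¹ ?_).inv
    rw [norm_inv]
    exact inv_le_one_of_one_le₀ h

/-- A root of a monic polynomial over `k((x))` with coefficients in `k⟦x⟧` is congruent to a
constant. -/
theorem exists_norm_sub_lt_one [IsAlgClosed k] {L : Type*} [NormedField L] [IsUltrametricDist L]
    [Algebra (LaurentSeries k) L]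
    (hL : ∀ a : LaurentSeries k,
      ‖algebraMap (LaurentSeries k) L a‖ = ‖algebraMap (LaurentSeries k) (Puiseux k) a‖)
    {P : (LaurentSeries k)[X]} (hP : P.Monic)
    (hcoeff : ∀ n, ∀ z < 0, (P.coeff n).coeff z = 0) {β : L} (hβ : ‖β‖ ≤ 1)
    (hroot : aeval β P = 0) :
    ∃ c : k, ‖β - algebraMap (LaurentSeries k) L (HahnSeries.C c)‖ < 1 := by
  let φ : k →+* L := (algebraMap (LaurentSeries k) L).comp HahnSeries.C
  -- The reduction of `P` modulo `x`.
  let Q : k[X] := ∑ i ∈ Finset.range (P.natDegree + 1), monomial i ((P.coeff i).coeff 0)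
  have hQc : Q.coeff P.natDegree = 1 := by
    simp [Q, coeff_monomial, hP.coeff_natDegree]
  have hQd : Q.natDegree ≤ P.natDegree :=
    natDegree_sum_le_of_forall_le _ _ fun i hi =>
      (natDegree_monomial_le _).trans (Nat.lt_succ_iff.1 (Finset.mem_range.1 hi))
  have hQ : Q.Monic := monic_of_natDegree_le_of_coeff_eq_one _ hQd hQc
  have hsmall : ‖eval₂ φ β Q‖ < 1 := by
    have hsub : eval₂ φ β Q = ∑ i ∈ Finset.range (P.natDegree + 1),
        algebraMap (LaurentSeries k) L (HahnSeries.C ((P.coeff i).coeff 0) - P.coeff i) * β ^ i := by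
      simp only [map_sub, sub_mul, Finset.sum_sub_distrib]
      rw [aeval_eq_sum_range] at hroot
      simp only [Algebra.smul_def] at hroot
      rw [hroot, sub_zero, eval₂_finsetSum]
      simp [eval₂_monomial, φ]
    rw [hsub]
    refine norm_multiset_sum_lt one_pos _ fun a ha => ?_
    obtain ⟨i, -, rfl⟩ := Multiset.mem_map.1 ha
    rw [norm_mul, norm_pow, hL]
    refine lt_of_le_of_lt (mul_le_of_le_one_right (norm_nonneg _)
      (pow_le_one₀ (norm_nonneg _) hβ)) ?_
    have h2 := (norm_laurent_le_exp_iff (HahnSeries.C ((P.coeff i).coeff 0) - P.coeff i) 1).2 ?_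
    · rw [norm_laurent] at h2
      refine h2.trans_lt ?_
      simp
    · intro z hz
      rw [HahnSeries.coeff_sub]
      rcases (Int.lt_add_one_iff.1 hz : z ≤ 0).eq_or_lt with rfl | hz
      · simp [HahnSeries.C_apply]
      · rw [hcoeff i z hz, HahnSeries.C_apply, HahnSeries.coeff_single_of_ne hz.ne, sub_zero]
  have hprod : eval₂ φ β Q = (Q.roots.map fun c => β - φ c).prod := by
    conv_lhs => rw [(IsAlgClosed.splits Q).eq_prod_roots_of_monic hQ]
    rw [eval₂_multiset_prod, Multiset.map_map]
    congr 1
    refine Multiset.map_congr rfl fun c _ => ?_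
    simp
  -- `Q` splits over `k`, so if `β` had distance at least 1 from every constant, then `Q(β)` would
  -- have norm at least 1.
  rw [hprod] at hsmall
  by_contra! hge
  refine absurd hsmall (not_lt.2 ?_)
  have : ∀ s : Multiset k, 1 ≤ ‖(s.map fun c => β - φ c).prod‖ := by
    intro s
    induction s using Multiset.induction with
    | empty => simp
    | cons c s ih =>
      rw [Multiset.map_cons, Multiset.prod_cons, norm_mul]
      exact one_le_mul_of_one_le_of_one_le (hge c) ih
  exact this _

/-- The Newton-Puiseux theorem. -/
instance isAlgClosed_puiseux [IsAlgClosed k] [CharZero k] : IsAlgClosed (Puiseux k) := by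
  let := laurentNontriviallyNormedField k
  have := completeSpace_laurent (k := k)
  have : IsUltrametricDist (LaurentSeries k) := isUltrametricDist_laurent
  let L := AlgebraicClosure (Puiseux k)
  have : Algebra.IsAlgebraic (LaurentSeries k) L := Algebra.IsAlgebraic.trans _ (Puiseux k) _
  let := spectralNorm.normedField (LaurentSeries k) L
  have hN : ∀ x : L, ‖x‖ = spectralNorm (LaurentSeries k) L x := fun _ => rfl
  have : IsUltrametricDist L :=
    IsUltrametricDist.isUltrametricDist_of_forall_norm_add_le_max_norm fun x y =>
      isNonarchimedean_spectralNorm x y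
  have hext : ∀ a : LaurentSeries k,
      ‖algebraMap (LaurentSeries k) L a‖ = ‖algebraMap (LaurentSeries k) (Puiseux k) a‖ :=
    fun a => spectralNorm_extends a
  -- The power with exponent `s.den` lies in `k((x))`, where the norm is known.
  have hmono : ∀ s : ℚ, ‖algebraMap (Puiseux k) L (mono s 1)‖ = Real.exp (-(s : ℝ)) := by
    intro s
    refine (pow_left_inj₀ (norm_nonneg _) (Real.exp_pos _).le s.den_nz).1 ?_
    rw [← norm_pow, ← map_pow, mono_pow, one_pow, mul_comm, Rat.mul_den_eq_num, mono_intCast,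
      ← IsScalarTower.algebraMap_apply, hext, ← mono_intCast, norm_mono one_ne_zero,
      ← Real.exp_nat_mul]
    congr 1
    have : (s : ℝ) * s.den = s.num := by exact_mod_cast Rat.mul_den_eq_num s
    push_cast
    linarith
  have hunit : ∀ β : L, ‖β‖ = 1 →
      ∃ c : k, ‖β - algebraMap (LaurentSeries k) L (HahnSeries.C c)‖ < 1 := by
    intro β hβ
    have hint : IsIntegral (LaurentSeries k) β := Algebra.IsIntegral.isIntegral β
    refine exists_norm_sub_lt_one hext (minpoly.monic hint) ?_ hβ.le
      (minpoly.aeval _ _)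
    intro n
    have h1 := (spectralValue_le_one_iff (minpoly.monic hint)).1 hβ.le n
    have h2 := norm_laurent_le_exp_iff ((minpoly (LaurentSeries k) β).coeff n) 0
    simp only [Int.cast_zero, neg_zero, Real.exp_zero] at h2
    exact h2.1 h1
  -- The norm of `α` is a root of the norm of the constant coefficient of its minimal polynomial,
  -- hence a rational power of `|x|`.
  have hval : ∀ α : L, α ≠ 0 → ∃ s : ℚ, ‖α‖ = Real.exp (-(s : ℝ)) := by
    intro α hα
    have h0 : ramify k 1 ((minpoly (LaurentSeries k) α).coeff 0) ≠ 0 := by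
      rw [(map_ne_zero_iff _ (ramify k 1).injective)]
      exact minpoly.coeff_zero_ne_zero (Algebra.IsIntegral.isIntegral α) hα
    refine ⟨(ramify k 1 ((minpoly (LaurentSeries k) α).coeff 0)).order /
      (minpoly (LaurentSeries k) α).natDegree, ?_⟩
    rw [hN, spectralNorm.spectralNorm_eq_norm_coeff_zero_rpow]
    change hahnAbs (ramify k 1 ((minpoly (LaurentSeries k) α).coeff 0)) ^ _ = _
    rw [hahnAbs_of_ne_zero h0, ← Real.exp_mul]
    push_cast
    ring_nf
  have hsurj : Function.Surjective (algebraMap (Puiseux k) L) := by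
    refine algebraMap_surjective_of_norm_approx ?_ ?_ ?_
    · intro n hn
      have hn' : (n : k) ≠ 0 := Nat.cast_ne_zero.2 hn
      have := hext n
      rw [map_natCast, map_natCast] at this
      rw [this, ← map_natCast (algebraMap (LaurentSeries k) (Puiseux k)),
        ← map_natCast (HahnSeries.C : k →+* LaurentSeries k), HahnSeries.C_apply, ← mono_intCast,
        norm_mono hn']
      simp
    · intro σ x
      exact (spectralNorm_eq_of_equiv (σ.restrictScalars (LaurentSeries k)) x).symm
    · intro α hα
      obtain ⟨s, hs⟩ := hval α hα
      set t := algebraMap (Puiseux k) L (mono s 1) with ht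
      have ht0 : t ≠ 0 := by
        rw [ht, _root_.map_ne_zero]
        exact mono_eq_zero_iff.not.2 one_ne_zero
      -- Dividing by `x^s` reduces the approximation to an element of norm 1.
      obtain ⟨c, hc⟩ := hunit (α / t) (by
        rw [norm_div, hs, hmono, div_self (Real.exp_pos _).ne'])
      refine ⟨mono s 1 * algebraMap (LaurentSeries k) (Puiseux k) (HahnSeries.C c), ?_⟩
      rw [map_mul, ← IsScalarTower.algebraMap_apply, ← ht]
      have : α - t * algebraMap (LaurentSeries k) L (HahnSeries.C c) =
          t * (α / t - algebraMap (LaurentSeries k) L (HahnSeries.C c)) := by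
        rw [mul_sub, mul_div_cancel₀ _ ht0]
      rw [this, norm_mul, hs, ← hmono s]
      exact mul_lt_of_lt_one_right (norm_pos_iff.2 ht0) hc
  refine IsAlgClosed.of_exists_root _ fun p _ hp => ?_
  obtain ⟨α, hα⟩ := IsAlgClosed.exists_aeval_eq_zero L p (degree_pos_of_irreducible hp).ne'
  obtain ⟨a, rfl⟩ := hsurj α
  refine ⟨a, ?_⟩
  rwa [aeval_algebraMap_apply, map_eq_zero, coe_aeval_eq_eval] at hα

end NewtonPuiseux

/-! ### Points of the Berkovich line as functions `a ↦ |X - a|`. -/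

section Seminorms

theorem le_of_forall_pow_le_mul_pow {a M : ℝ} (hM : 0 ≤ M)
    (h : ∀ n : ℕ, a ^ n ≤ (n + 1) * M ^ n) : a ≤ M := by
  by_contra! hlt
  rcases hM.eq_or_lt with rfl | hM
  · have := h 1
    norm_num at this
    linarith
  have hρ : 1 < a / M := (one_lt_div hM).2 hlt
  have ht := tendsto_pow_const_div_const_pow_of_one_lt 1 hρ
  obtain ⟨n, hn, hn1⟩ := ((ht.eventually_lt_const (by norm_num : (0 : ℝ) < 1 / 2)).and
    (Filter.eventually_ge_atTop 1)).exists
  have h1 : (a / M) ^ n ≤ n + 1 := by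
    rw [div_pow, div_le_iff₀ (by positivity)]
    exact h n
  rw [pow_one, div_lt_iff₀ (by positivity)] at hn
  have : (1 : ℝ) ≤ n := by exact_mod_cast hn1
  linarith

variable {K : Type*} [NormedField K]

namespace BerkovichA1

theorem apply_nonneg (ζ : BerkovichA1 K) (f : K[X]) : 0 ≤ ζ f :=
  NonnegHomClass.apply_nonneg ζ.toSeminorm f

/-- The distance `|X - a|_ζ` from a point of the Berkovich line to `a`. -/
def ptDist (ζ : BerkovichA1 K) (a : K) : ℝ := ζ (X - C a)

theorem ptDist_nonneg (ζ : BerkovichA1 K) (a : K) : 0 ≤ ζ.ptDist a := apply_nonneg _ _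

theorem continuous_apply (f : K[X]) : Continuous fun ζ : BerkovichA1 K => ζ f :=
  (_root_.continuous_apply f).comp continuous_induced_dom

theorem continuous_ptDist (a : K) : Continuous fun ζ : BerkovichA1 K => ζ.ptDist a :=
  continuous_apply _

section Ultrametric

variable [IsUltrametricDist K]

/-- Expand `(f + g) ^ n`: there are `n + 1` terms with binomial coefficients of norm at most 1, and
the factor `n + 1` disappears on taking `n`-th roots. So the seminorms are automatically
nonarchimedean. -/
theorem apply_add_le_max (ζ : BerkovichA1 K) (f g : K[X]) : ζ (f + g) ≤ max (ζ f) (ζ g) := by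
  have h0 : 0 ≤ max (ζ f) (ζ g) := le_max_of_le_left (ζ.apply_nonneg f)
  refine le_of_forall_pow_le_mul_pow h0 fun n => ?_
  have hsum : ∀ (s : Finset ℕ) (F : ℕ → K[X]), ζ (∑ i ∈ s, F i) ≤ ∑ i ∈ s, ζ (F i) := fun s F =>
    Finset.le_sum_of_subadditive _ (map_zero ζ.toSeminorm).le (map_add_le_add ζ.toSeminorm) _ _
  calc ζ (f + g) ^ n = ζ ((f + g) ^ n) := (map_pow ζ.toSeminorm _ _).symm
    _ ≤ ∑ i ∈ Finset.range (n + 1), ζ (f ^ i * g ^ (n - i) * (n.choose i : K[X])) := by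
      rw [add_pow]
      exact hsum _ _
    _ ≤ ∑ i ∈ Finset.range (n + 1), max (ζ f) (ζ g) ^ n := by
      refine Finset.sum_le_sum fun i hi => ?_
      have hi' : i ≤ n := Nat.lt_succ_iff.1 (Finset.mem_range.1 hi)
      have hc : ζ (n.choose i : K[X]) ≤ 1 := by
        rw [← C_eq_natCast, ζ.map_C']
        exact IsUltrametricDist.norm_natCast_le_one K _
      rw [map_mul, map_mul, map_pow, map_pow]
      refine (mul_le_of_le_one_right (by positivity) hc).trans ?_
      calc ζ f ^ i * ζ g ^ (n - i) ≤ max (ζ f) (ζ g) ^ i * max (ζ f) (ζ g) ^ (n - i) := by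
            gcongr
            · exact le_max_left _ _
            · exact le_max_right _ _
        _ = _ := by rw [← pow_add, Nat.add_sub_cancel' hi']
    _ = _ := by simp

theorem ptDist_le_max (ζ : BerkovichA1 K) (a b : K) : ζ.ptDist b ≤ max (ζ.ptDist a) ‖a - b‖ := by
  have h := ζ.apply_add_le_max (X - C a) (C (a - b))
  rw [ζ.map_C', C_sub, sub_add_sub_cancel] at h
  exact h

theorem norm_sub_le_max (ζ : BerkovichA1 K) (a b : K) :
    ‖a - b‖ ≤ max (ζ.ptDist a) (ζ.ptDist b) := by
  have h := ζ.apply_add_le_max (X - C b) (-(X - C a))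
  rw [map_neg_eq_map, neg_sub, add_comm, sub_add_sub_cancel, ← C_sub, ζ.map_C'] at h
  rwa [max_comm]

theorem ptDist_diskPoint_self (a : K) (r : ℝ) (hr : 0 < r) : (diskPoint a r hr).ptDist a = r := by
  change (taylor a (X - C a)).gaussNorm (NormedField.toAbsoluteValue K) r = r
  rw [map_sub, taylor_X, taylor_C, add_sub_cancel_right, ← monomial_one_one_eq_X,
    gaussNorm_monomial]
  simp

theorem le_ptDist_diskPoint (a b : K) (r : ℝ) (hr : 0 < r) : r ≤ (diskPoint a r hr).ptDist b := by
  refine le_trans (le_of_eq ?_)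
    (le_gaussNorm (NormedField.toAbsoluteValue K) (taylor a (X - C b)) hr.le 1)
  rw [map_sub, taylor_X, taylor_C]
  simp [coeff_X]

theorem ptDist_diskPoint (a b : K) (r : ℝ) (hr : 0 < r) :
    (diskPoint a r hr).ptDist b = max r ‖a - b‖ := by
  refine le_antisymm ?_ (max_le (le_ptDist_diskPoint a b r hr) ?_)
  · have := (diskPoint a r hr).ptDist_le_max a b
    rwa [ptDist_diskPoint_self] at this
  · have := (diskPoint a r hr).norm_sub_le_max a b
    rw [ptDist_diskPoint_self] at this
    exact this.trans (max_le (le_ptDist_diskPoint a b r hr) le_rfl)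

open Classical in
/-- The point at height `r` above `ζ` on the way to `∞`; it is `ζ` itself for small `r`. -/
def join (ζ : BerkovichA1 K) (r : ℝ) : BerkovichA1 K :=
  if h : 0 < r ∧ ∃ a, ζ.ptDist a ≤ r then diskPoint h.2.choose r h.1 else ζ

/-- This formula shows that the centre chosen in `join` is immaterial. When no centre is available,
either `r ≤ 0` or all values of `ptDist` exceed `r`, so the maximum changes nothing. -/
theorem ptDist_join (ζ : BerkovichA1 K) (r : ℝ) (b : K) :
    (ζ.join r).ptDist b = max (ζ.ptDist b) r := by
  rw [join]
  split_ifs with h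
  · have ha := h.2.choose_spec
    set a := h.2.choose
    rw [ptDist_diskPoint]
    refine le_antisymm (max_le (le_max_right _ _) ?_) (max_le ?_ (le_max_left _ _))
    · refine (ζ.norm_sub_le_max a b).trans (max_le (ha.trans (le_max_right _ _)) (le_max_left _ _))
    · exact (ζ.ptDist_le_max a b).trans (max_le_max_right _ ha)
  · push Not at h
    symm
    rw [max_eq_left_iff]
    by_cases hr : 0 < r
    · exact (h hr b).le
    · exact (not_lt.1 hr).trans (ζ.ptDist_nonneg b)

end Ultrametric

section AlgClosed

variable [IsAlgClosed K]

/-- By factoring into linear polynomials, the functions `ptDist` become coordinates, for equality as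
well as for continuity. -/
theorem apply_eq_prod_ptDist (ζ : BerkovichA1 K) (f : K[X]) :
    ζ f = ‖f.leadingCoeff‖ * (f.roots.map ζ.ptDist).prod := by
  conv_lhs => rw [(IsAlgClosed.splits f).eq_prod_roots]
  rw [map_mul, ζ.map_C', map_multiset_prod, Multiset.map_map]
  rfl

theorem ext_ptDist {ζ ξ : BerkovichA1 K} (h : ∀ a, ζ.ptDist a = ξ.ptDist a) : ζ = ξ := by
  apply BerkovichA1.ext
  apply DFunLike.ext
  intro f
  rw [apply_eq_prod_ptDist, apply_eq_prod_ptDist, funext h]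

theorem continuous_of_ptDist {Y : Type*} [TopologicalSpace Y] {F : Y → BerkovichA1 K}
    (h : ∀ a, Continuous fun y => (F y).ptDist a) : Continuous F := by
  refine continuous_induced_rng.2 (continuous_pi fun f => ?_)
  simp only [Function.comp_apply, apply_eq_prod_ptDist]
  exact continuous_const.mul (continuous_multiset_prod f.roots fun a _ => h a)

variable [IsUltrametricDist K]

/-- The seminorm axioms are closed conditions, and factoring bounds every coordinate, so the set is
closed in a product of compact intervals. It serves to make `outside a r` an open neighbourhood of
`∞`. -/
theorem isCompact_setOf_ptDist_le (a : K) (r : ℝ) :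
    IsCompact {ζ : BerkovichA1 K | ζ.ptDist a ≤ r} := by
  let e : BerkovichA1 K → K[X] → ℝ := fun ζ f => ζ f
  have he : IsInducing e := ⟨rfl⟩
  rw [he.isCompact_iff]
  let M : K[X] → ℝ := fun f => ‖f.leadingCoeff‖ * (f.roots.map fun b => max r ‖a - b‖).prod
  refine IsCompact.of_isClosed_subset (isCompact_univ_pi fun f => isCompact_Icc (a := 0) (b := M f))
    ?_ ?_
  · have himg : e '' {ζ : BerkovichA1 K | ζ.ptDist a ≤ r} =
        {F | F 1 = 1} ∩ ⋂ (f : K[X]) (g : K[X]) (c : K), {F : K[X] → ℝ | F (f + g) ≤ F f + F g} ∩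
          {F | F (-f) = F f} ∩ {F | F (f * g) = F f * F g} ∩ {F | F (C c) = ‖c‖} ∩
          {F | F (X - C a) ≤ r} := by
      ext F
      simp only [Set.mem_image, Set.mem_ofPred_eq, Set.mem_inter_iff, Set.mem_iInter]
      constructor
      · rintro ⟨ζ, hζ, rfl⟩
        exact ⟨map_one ζ.toSeminorm, fun f g c => ⟨⟨⟨⟨map_add_le_add ζ.toSeminorm f g,
          map_neg_eq_map ζ.toSeminorm f⟩, map_mul ζ.toSeminorm f g⟩, ζ.map_C' c⟩, hζ⟩⟩
      · rintro ⟨h1, h⟩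
        let v : MulRingSeminorm K[X] :=
          { toFun := F
            map_zero' := by simpa using (h 0 0 0).1.2
            add_le' := fun f g => (h f g 0).1.1.1.1
            neg' := fun f => (h f 0 0).1.1.1.2
            map_one' := h1
            map_mul' := fun f g => (h f g 0).1.1.2 }
        exact ⟨⟨v, fun c => (h 0 0 c).1.2⟩, (h 0 0 0).2, rfl⟩
    rw [himg]
    refine (isClosed_eq (_root_.continuous_apply _) continuous_const).inter
      (isClosed_iInter fun f => isClosed_iInter fun g => isClosed_iInter fun c => ?_)
    refine ((((isClosed_le ?_ ?_).inter (isClosed_eq ?_ ?_)).inter (isClosed_eq ?_ ?_)).inter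
      (isClosed_eq ?_ ?_)).inter (isClosed_le ?_ ?_) <;> fun_prop
  · rintro _ ⟨ζ, hζ, rfl⟩ f -
    refine ⟨ζ.apply_nonneg f, ?_⟩
    change ζ f ≤ _
    rw [apply_eq_prod_ptDist]
    refine mul_le_mul_of_nonneg_left ?_ (norm_nonneg _)
    exact Multiset.prod_map_le_prod_map₀ _ _ (fun b _ => ζ.ptDist_nonneg b)
      fun b _ => (ζ.ptDist_le_max a b).trans (max_le_max_right _ hζ)

theorem continuous_join (ζ : BerkovichA1 K) : Continuous ζ.join :=
  continuous_of_ptDist fun a => by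
    simp only [ptDist_join]
    exact continuous_const.max continuous_id

theorem join_zero (ζ : BerkovichA1 K) : ζ.join 0 = ζ :=
  ext_ptDist fun a => by rw [ptDist_join, max_eq_left (ζ.ptDist_nonneg a)]

theorem join_eq_diskPoint {ζ : BerkovichA1 K} {a : K} {r : ℝ} (hr : 0 < r) (h : ζ.ptDist a ≤ r) :
    ζ.join r = diskPoint a r hr :=
  ext_ptDist fun b => by
    rw [ptDist_join, ptDist_diskPoint]
    refine le_antisymm (max_le ?_ (le_max_left _ _)) (max_le (le_max_right _ _) ?_)
    · exact (ζ.ptDist_le_max a b).trans (max_le_max_right _ h)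
    · exact (ζ.norm_sub_le_max a b).trans (max_le (h.trans (le_max_right _ _)) (le_max_left _ _))

theorem exists_ptDist_lt_of_join_ne {ζ : BerkovichA1 K} {r : ℝ} (h : ζ.join r ≠ ζ) :
    ∃ a, ζ.ptDist a < r := by
  by_contra! hle
  exact h (ext_ptDist fun a => by rw [ptDist_join, max_eq_left (hle a)])

end AlgClosed

end BerkovichA1

end Seminorms

/-! ### Convex hulls as intersections of connected sets. -/

section Hull

variable {T : Type*} [TopologicalSpace T]

theorem mem_hull_iff {Γ : Set T} {η : T} :
    η ∈ hull Γ ↔ ∀ S, IsPreconnected S → Γ ⊆ S → η ∈ S := by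
  simp only [hull, Set.mem_sInter, Set.mem_ofPred_eq, and_imp]

theorem hull_mono {Γ Δ : Set T} (h : Γ ⊆ Δ) : hull Γ ⊆ hull Δ := fun _ hη =>
  mem_hull_iff.2 fun S hS hΔ => mem_hull_iff.1 hη S hS (h.trans hΔ)

theorem subset_hull (Γ : Set T) : Γ ⊆ hull Γ := fun _ hη => mem_hull_iff.2 fun _ _ h => h hη

theorem hull_subset {Γ S : Set T} (hS : IsPreconnected S) (h : Γ ⊆ S) : hull Γ ⊆ S := fun _ hη =>
  mem_hull_iff.1 hη S hS h

theorem isPreconnected_hull_of_subset {Γ S : Set T} (hS : IsPreconnected S) (hΓ : Γ ⊆ S)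
    (h : S ⊆ hull Γ) : IsPreconnected (hull Γ) := by
  rwa [(hull_subset hS hΓ).antisymm h]

end Hull

/-! ### The tree structure of the projective line: directions, segments, medians. -/

section Topology

open OnePoint

variable {K : Type*} [NormedField K]

/-- The open ball of centre `a` and radius `r` in the Berkovich line. -/
def ball (a : K) (r : ℝ) : Set (BerkovichP1 K) :=
  (↑) '' {ζ : BerkovichA1 K | ζ.ptDist a < r}

/-- The complement in the projective line of the closed ball of centre `a` and radius `r`. -/
def outside (a : K) (r : ℝ) : Set (BerkovichP1 K) :=
  ((↑) '' {ζ : BerkovichA1 K | ζ.ptDist a ≤ r})ᶜ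

theorem coe_mem_ball {ζ : BerkovichA1 K} {a : K} {r : ℝ} :
    (ζ : BerkovichP1 K) ∈ ball a r ↔ ζ.ptDist a < r :=
  coe_injective.mem_set_image

theorem infty_notMem_ball (a : K) (r : ℝ) : (∞ : BerkovichP1 K) ∉ ball a r := by
  rintro ⟨ζ, -, h⟩
  exact coe_ne_infty _ h

theorem coe_mem_outside {ζ : BerkovichA1 K} {a : K} {r : ℝ} :
    (ζ : BerkovichP1 K) ∈ outside a r ↔ r < ζ.ptDist a := by
  rw [outside, Set.mem_compl_iff, coe_injective.mem_set_image, Set.mem_ofPred_eq, not_le]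

theorem infty_mem_outside (a : K) (r : ℝ) : (∞ : BerkovichP1 K) ∈ outside a r := by
  rintro ⟨ζ, -, h⟩
  exact coe_ne_infty _ h

theorem isOpen_ball (a : K) (r : ℝ) : IsOpen (ball a r) :=
  isOpen_image_coe.2 (isOpen_lt (BerkovichA1.continuous_ptDist a) continuous_const)

variable [IsUltrametricDist K]

theorem ball_subset_ball {a b : K} {r : ℝ} (h : ‖a - b‖ < r) : ball a r ⊆ ball b r := by
  rintro _ ⟨ζ, hζ, rfl⟩
  exact coe_mem_ball.2 ((ζ.ptDist_le_max a b).trans_lt (max_lt hζ h))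

theorem notMem_ball_of_mem_ball {a b : K} {r : ℝ} (h : r ≤ ‖a - b‖) {p : BerkovichP1 K}
    (ha : p ∈ ball a r) : p ∉ ball b r := by
  obtain ⟨ζ, hζ, rfl⟩ := ha
  intro hb
  exact absurd ((ζ.norm_sub_le_max a b).trans_lt (max_lt hζ (coe_mem_ball.1 hb))) (not_lt.2 h)

theorem notMem_ball_of_mem_outside {a b : K} {r : ℝ} (h : ‖a - b‖ ≤ r) {p : BerkovichP1 K}
    (hp : p ∈ outside a r) : p ∉ ball b r := by
  rintro ⟨ζ, hζ, rfl⟩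
  refine absurd (coe_mem_outside.1 hp) (not_lt.2 ((ζ.ptDist_le_max b a).trans (max_le hζ.le ?_)))
  rwa [norm_sub_rev]

theorem diskPoint_notMem_ball {a b : K} {r : ℝ} (hr : 0 < r) :
    (diskPoint a r hr : BerkovichP1 K) ∉ ball b r := fun h =>
  absurd (coe_mem_ball.1 h) (not_lt.2 (BerkovichA1.le_ptDist_diskPoint a b r hr))

theorem diskPoint_notMem_outside {a : K} {r : ℝ} (hr : 0 < r) :
    (diskPoint a r hr : BerkovichP1 K) ∉ outside a r := fun h => by
  rw [coe_mem_outside, BerkovichA1.ptDist_diskPoint_self] at h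
  exact lt_irrefl _ h

/-- The path from `ζ` towards `∞`, up to height `d`. -/
def chain (ζ : BerkovichA1 K) (d : ℝ) : Set (BerkovichP1 K) :=
  (fun t => (ζ.join t : BerkovichP1 K)) '' Set.Icc 0 d

theorem join_mem_chain (ζ : BerkovichA1 K) {d : ℝ} (hd : 0 ≤ d) :
    (ζ.join d : BerkovichP1 K) ∈ chain ζ d :=
  ⟨d, ⟨hd, le_rfl⟩, rfl⟩

theorem tendsto_join_infty (ζ : BerkovichA1 K) :
    Filter.Tendsto (fun t => (ζ.join t : BerkovichP1 K)) Filter.atTop (𝓝 ∞) := by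
  refine tendsto_coe_infty.comp (Filter.hasBasis_coclosedCompact.tendsto_right_iff.2 ?_)
  rintro S ⟨-, hS⟩
  obtain ⟨B, hB⟩ := hS.bddAbove_image (BerkovichA1.continuous_ptDist (0 : K)).continuousOn
  filter_upwards [Filter.eventually_gt_atTop B] with t ht hmem
  have h1 : (ζ.join t).ptDist 0 ≤ B := hB ⟨_, hmem, rfl⟩
  rw [BerkovichA1.ptDist_join] at h1
  exact absurd ((le_max_right _ _).trans h1) (not_le.2 ht)

/-- The path from `ζ` to `∞`. -/
def ray (ζ : BerkovichA1 K) : Set (BerkovichP1 K) :=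
  insert ∞ ((fun t => (ζ.join t : BerkovichP1 K)) '' Set.Ici 0)

theorem chain_subset_ray (ζ : BerkovichA1 K) (d : ℝ) : chain ζ d ⊆ ray ζ :=
  (Set.image_mono Set.Icc_subset_Ici_self).trans (Set.subset_insert _ _)

/-- The points `ζ(a, r)` with `r > 0`. -/
def IsDiskPoint (η : BerkovichP1 K) : Prop :=
  ∃ (a : K) (r : ℝ) (hr : 0 < r), η = (diskPoint a r hr : BerkovichA1 K)

theorem isDiskPoint_join {ζ : BerkovichA1 K} (hζ : IsDiskPoint (ζ : BerkovichP1 K)) (t : ℝ) :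
    IsDiskPoint (ζ.join t : BerkovichP1 K) := by
  rw [BerkovichA1.join]
  split_ifs with h
  · exact ⟨_, t, h.1, rfl⟩
  · exact hζ

variable [IsAlgClosed K]

theorem isOpen_outside (a : K) (r : ℝ) : IsOpen (outside a r) :=
  isOpen_compl_image_coe.2
    ⟨isClosed_le (BerkovichA1.continuous_ptDist a) continuous_const,
      BerkovichA1.isCompact_setOf_ptDist_le a r⟩

theorem diskPoint_eq_of_norm_sub_le {a b : K} {r : ℝ} (hr : 0 < r) (h : ‖a - b‖ ≤ r) :
    diskPoint a r hr = diskPoint b r hr := by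
  have h1 : (diskPoint a r hr).ptDist b ≤ r := by
    rw [BerkovichA1.ptDist_diskPoint]
    exact max_le le_rfl h
  rw [← BerkovichA1.join_eq_diskPoint hr h1,
    BerkovichA1.join_eq_diskPoint hr (BerkovichA1.ptDist_diskPoint_self a r hr).le]

/-- A point other than `ζ(a, r)` lies in one of the directions at `ζ(a, r)`. -/
theorem mem_outside_or_exists_mem_ball {a : K} {r : ℝ} (hr : 0 < r) {p : BerkovichP1 K}
    (hp : p ≠ diskPoint a r hr) : p ∈ outside a r ∨ ∃ b, ‖a - b‖ ≤ r ∧ p ∈ ball b r := by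
  induction p using OnePoint.rec with
  | infty => exact Or.inl (infty_mem_outside a r)
  | coe ζ =>
    by_contra! h
    obtain ⟨h1, h2⟩ := h
    rw [coe_mem_outside, not_lt] at h1
    obtain ⟨b, hb⟩ : ∃ b, ζ.ptDist b < r := by
      apply BerkovichA1.exists_ptDist_lt_of_join_ne
      rw [BerkovichA1.join_eq_diskPoint hr h1]
      exact fun h => hp (congrArg _ h.symm)
    exact h2 b ((ζ.norm_sub_le_max a b).trans (max_le h1 hb.le)) (coe_mem_ball.2 hb)

/-- Without `ζ(a, r)` the line is the disjoint union of the open ball and the other directions,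
which also form an open set; a connected set meeting both must contain `ζ(a, r)`. -/
theorem diskPoint_mem_hull_of_mem_ball {a : K} {r : ℝ} (hr : 0 < r) {p q : BerkovichP1 K}
    (hp : p ∈ ball a r) (hq : q ∉ ball a r) :
    (diskPoint a r hr : BerkovichP1 K) ∈ hull {p, q} := by
  refine mem_hull_iff.2 fun C hC hpq => ?_
  by_contra hη
  have hpC : p ∈ C := hpq (by simp)
  have hqC : q ∈ C := hpq (by simp)
  let O : Set (BerkovichP1 K) := outside a r ∪ ⋃ (b : K) (_ : ‖a - b‖ = r), ball b r
  have hO : IsOpen O := (isOpen_outside a r).union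
    (isOpen_iUnion fun b => isOpen_iUnion fun _ => isOpen_ball b r)
  have hcover : C ⊆ ball a r ∪ O := by
    intro s hs
    rcases mem_outside_or_exists_mem_ball hr (fun h => hη (h ▸ hs)) with h | ⟨b, hb, h⟩
    · exact Or.inr (Or.inl h)
    · rcases hb.eq_or_lt with hb | hb
      · exact Or.inr (Or.inr (Set.mem_iUnion₂.2 ⟨b, hb, h⟩))
      · exact Or.inl (ball_subset_ball (by rwa [norm_sub_rev]) h)
  obtain ⟨s, -, hs, hs'⟩ := hC _ _ (isOpen_ball a r) hO hcover ⟨p, hpC, hp⟩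
    ⟨q, hqC, (hcover hqC).resolve_left hq⟩
  rcases hs' with h | h
  · exact notMem_ball_of_mem_outside (by simpa using hr.le) h hs
  · obtain ⟨b, hb, h⟩ := Set.mem_iUnion₂.1 h
    exact notMem_ball_of_mem_ball hb.ge hs h

theorem continuous_coe_join (ζ : BerkovichA1 K) :
    Continuous fun t => (ζ.join t : BerkovichP1 K) :=
  continuous_coe.comp ζ.continuous_join

theorem isPreconnected_chain (ζ : BerkovichA1 K) (d : ℝ) : IsPreconnected (chain ζ d) :=
  isPreconnected_Icc.image _ (continuous_coe_join ζ).continuousOn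

theorem self_mem_chain (ζ : BerkovichA1 K) {d : ℝ} (hd : 0 ≤ d) :
    (ζ : BerkovichP1 K) ∈ chain ζ d :=
  ⟨0, ⟨le_rfl, hd⟩, by simp only [ζ.join_zero]⟩

theorem isPreconnected_chain_union_chain {ζ ξ : BerkovichA1 K} {d : ℝ} (hd : 0 ≤ d)
    (h : ζ.join d = ξ.join d) : IsPreconnected (chain ζ d ∪ chain ξ d) :=
  (isPreconnected_chain ζ d).union (ζ.join d : BerkovichP1 K) (join_mem_chain ζ hd)
    (by rw [h]; exact join_mem_chain ξ hd) (isPreconnected_chain ξ d)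

theorem isPreconnected_ray (ζ : BerkovichA1 K) : IsPreconnected (ray ζ) := by
  refine (isPreconnected_Ici.image _ (continuous_coe_join ζ).continuousOn).subset_closure
    (Set.subset_insert _ _) (Set.insert_subset ?_ subset_closure)
  refine mem_closure_of_tendsto (tendsto_join_infty ζ) ?_
  filter_upwards [Filter.eventually_ge_atTop 0] with t ht
  exact ⟨t, ht, rfl⟩

theorem self_mem_ray (ζ : BerkovichA1 K) : (ζ : BerkovichP1 K) ∈ ray ζ :=
  Or.inr ⟨0, Set.self_mem_Ici, by simp only [ζ.join_zero]⟩

theorem isPreconnected_outside (a : K) (r : ℝ) : IsPreconnected (outside a r) := by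
  refine isPreconnected_of_forall ∞ fun p hp => ?_
  induction p using OnePoint.rec with
  | infty => exact ⟨{∞}, by simpa using hp, rfl, rfl, isPreconnected_singleton⟩
  | coe ζ =>
    refine ⟨ray ζ, ?_, Or.inl rfl, self_mem_ray ζ, isPreconnected_ray ζ⟩
    rintro _ (rfl | ⟨t, -, rfl⟩)
    · exact infty_mem_outside a r
    · rw [coe_mem_outside] at hp ⊢
      rw [BerkovichA1.ptDist_join]
      exact lt_max_of_lt_left hp

theorem isPreconnected_ball (a : K) (r : ℝ) : IsPreconnected (ball a r) := by
  refine isPreconnected_of_forall_pair ?_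
  rintro _ ⟨ζ, hζ, rfl⟩ _ ⟨ξ, hξ, rfl⟩
  obtain ⟨t, ht, htr⟩ := exists_between (max_lt (coe_mem_ball.1 ⟨ζ, hζ, rfl⟩)
    (coe_mem_ball.1 ⟨ξ, hξ, rfl⟩))
  obtain ⟨h1, h2⟩ := max_lt_iff.1 ht
  have ht0 : 0 < t := (ζ.ptDist_nonneg a).trans_lt h1
  have hsub : ∀ η : BerkovichA1 K, η.ptDist a < t → chain η t ⊆ ball a r := by
    rintro η hη _ ⟨u, hu, rfl⟩
    rw [coe_mem_ball, BerkovichA1.ptDist_join]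
    exact (max_le hη.le hu.2).trans_lt htr
  refine ⟨chain ζ t ∪ chain ξ t, Set.union_subset (hsub ζ h1) (hsub ξ h2),
    Or.inl (self_mem_chain ζ ht0.le), Or.inr (self_mem_chain ξ ht0.le),
    isPreconnected_chain_union_chain ht0.le ?_⟩
  rw [BerkovichA1.join_eq_diskPoint ht0 h1.le, BerkovichA1.join_eq_diskPoint ht0 h2.le]

/-- The height at which the paths from `ζ` and `ξ` to `∞` meet. -/
theorem exists_isLeast_join_eq (ζ ξ : BerkovichA1 K) :
    ∃ d, IsLeast {t : ℝ | 0 ≤ t ∧ ζ.join t = ξ.join t} d := by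
  have hset : {t : ℝ | 0 ≤ t ∧ ζ.join t = ξ.join t} =
      Set.Ici 0 ∩ ⋂ a, {t | max (ζ.ptDist a) t = max (ξ.ptDist a) t} := by
    ext t
    simp only [Set.mem_ofPred_eq, Set.mem_inter_iff, Set.mem_Ici, Set.mem_iInter,
      ← BerkovichA1.ptDist_join]
    exact and_congr_right fun _ => ⟨fun h a => by rw [h], BerkovichA1.ext_ptDist⟩
  have hcl : IsClosed {t : ℝ | 0 ≤ t ∧ ζ.join t = ξ.join t} := by
    rw [hset]
    exact isClosed_Ici.inter (isClosed_iInter fun a => isClosed_eq (by fun_prop) (by fun_prop))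
  refine ⟨_, hcl.isLeast_csInf ⟨max (max (ζ.ptDist 0) (ξ.ptDist 0)) 1, by positivity, ?_⟩
    ⟨0, fun t ht => ht.1⟩⟩
  rw [BerkovichA1.join_eq_diskPoint (a := (0 : K)) (by positivity)
      ((le_max_left _ _).trans (le_max_left _ _)),
    BerkovichA1.join_eq_diskPoint (a := (0 : K)) (by positivity)
      ((le_max_right _ _).trans (le_max_left _ _))]

/-- A point at height `t ≤ d` on the path separates `ζ` from `ξ`: if `ξ` lay in the same ball of
radius `t`, the two paths would already meet at some height `u < t`. -/
theorem chain_subset_hull {ζ ξ : BerkovichA1 K} {d : ℝ}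
    (hd : d ∈ lowerBounds {t : ℝ | 0 ≤ t ∧ ζ.join t = ξ.join t}) :
    chain ζ d ⊆ hull {(ζ : BerkovichP1 K), (ξ : BerkovichP1 K)} := by
  rintro _ ⟨t, ht, rfl⟩
  change (ζ.join t : BerkovichP1 K) ∈ _
  by_cases hne : ζ.join t = ζ
  · rw [hne]
    exact subset_hull _ (by simp)
  obtain ⟨a, ha⟩ := BerkovichA1.exists_ptDist_lt_of_join_ne hne
  have ht0 : 0 < t := (ζ.ptDist_nonneg a).trans_lt ha
  rw [BerkovichA1.join_eq_diskPoint ht0 ha.le]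
  refine diskPoint_mem_hull_of_mem_ball ht0 (coe_mem_ball.2 ha) fun hξ => ?_
  obtain ⟨u, hu, hut⟩ := exists_between (max_lt ha (coe_mem_ball.1 hξ))
  obtain ⟨h1, h2⟩ := max_lt_iff.1 hu
  have hu0 : 0 < u := (ζ.ptDist_nonneg a).trans_lt h1
  have := hd ⟨hu0.le, by
    rw [BerkovichA1.join_eq_diskPoint hu0 h1.le, BerkovichA1.join_eq_diskPoint hu0 h2.le]⟩
  exact absurd (ht.2.trans this) (not_le.2 hut)

theorem ray_subset_hull (ζ : BerkovichA1 K) : ray ζ ⊆ hull {(ζ : BerkovichP1 K), ∞} := by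
  rintro _ (rfl | ⟨t, -, rfl⟩)
  · exact subset_hull _ (by simp)
  change (ζ.join t : BerkovichP1 K) ∈ _
  by_cases hne : ζ.join t = ζ
  · rw [hne]
    exact subset_hull _ (by simp)
  obtain ⟨a, ha⟩ := BerkovichA1.exists_ptDist_lt_of_join_ne hne
  have ht0 : 0 < t := (ζ.ptDist_nonneg a).trans_lt ha
  rw [BerkovichA1.join_eq_diskPoint ht0 ha.le]
  exact diskPoint_mem_hull_of_mem_ball ht0 (coe_mem_ball.2 ha) (infty_notMem_ball a t)

/-- An intersection of connected sets need not be connected; here the hull equals an explicit path,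
one chain on each side up to the meeting height, or a ray if one end is `∞`. -/
theorem isPreconnected_hull_pair (p q : BerkovichP1 K) : IsPreconnected (hull {p, q}) := by
  induction p using OnePoint.rec with
  | infty =>
    induction q using OnePoint.rec with
    | infty =>
      rw [Set.pair_eq_singleton]
      exact isPreconnected_hull_of_subset isPreconnected_singleton le_rfl (subset_hull _)
    | coe ξ =>
      rw [Set.pair_comm]
      exact isPreconnected_hull_of_subset (isPreconnected_ray ξ)
        (Set.pair_subset (self_mem_ray ξ) (Or.inl rfl)) (ray_subset_hull ξ)
  | coe ζ =>
    induction q using OnePoint.rec with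
    | infty =>
      exact isPreconnected_hull_of_subset (isPreconnected_ray ζ)
        (Set.pair_subset (self_mem_ray ζ) (Or.inl rfl)) (ray_subset_hull ζ)
    | coe ξ =>
      obtain ⟨d, hd⟩ := exists_isLeast_join_eq ζ ξ
      refine isPreconnected_hull_of_subset (isPreconnected_chain_union_chain hd.1.1 hd.1.2)
        (Set.pair_subset (Or.inl (self_mem_chain ζ hd.1.1)) (Or.inr (self_mem_chain ξ hd.1.1)))
        (Set.union_subset (chain_subset_hull hd.2) ?_)
      rw [Set.pair_comm]
      exact chain_subset_hull (by simpa only [eq_comm] using hd.2)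

theorem preconnectedSpace_berkovichP1 : PreconnectedSpace (BerkovichP1 K) :=
  ⟨isPreconnected_of_forall_pair fun p _ q _ => ⟨hull {p, q}, Set.subset_univ _,
    subset_hull _ (by simp), subset_hull _ (by simp), isPreconnected_hull_pair p q⟩⟩

/-- The median of two disk points and a third point. -/
theorem exists_isDiskPoint_mem_hull {ζ₁ ζ₂ : BerkovichP1 K} (h₁ : IsDiskPoint ζ₁)
    (h₂ : IsDiskPoint ζ₂) (p : BerkovichP1 K) :
    ∃ η, IsDiskPoint η ∧ η ∈ hull {ζ₁, ζ₂} ∧ η ∈ hull {ζ₁, p} ∧ η ∈ hull {ζ₂, p} := by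
  obtain ⟨a₁, r₁, hr₁, rfl⟩ := id h₁
  obtain ⟨a₂, r₂, hr₂, rfl⟩ := id h₂
  set ζ₁ := diskPoint a₁ r₁ hr₁
  set ζ₂ := diskPoint a₂ r₂ hr₂
  obtain ⟨d, ⟨hd0, hd⟩, hdl⟩ := exists_isLeast_join_eq ζ₁ ζ₂
  have hdl' : d ∈ lowerBounds {t : ℝ | 0 ≤ t ∧ ζ₂.join t = ζ₁.join t} := by
    simpa only [eq_comm] using hdl
  induction p using OnePoint.rec with
  | infty =>
    refine ⟨ζ₁.join d, isDiskPoint_join h₁ d, chain_subset_hull hdl (join_mem_chain _ hd0),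
      ray_subset_hull _ (chain_subset_ray _ _ (join_mem_chain _ hd0)), ?_⟩
    rw [hd]
    exact ray_subset_hull _ (chain_subset_ray _ _ (join_mem_chain _ hd0))
  | coe ξ =>
    obtain ⟨e, ⟨he0, he⟩, hel⟩ := exists_isLeast_join_eq ζ₁ ξ
    have hel' : e ∈ lowerBounds {t : ℝ | 0 ≤ t ∧ ξ.join t = ζ₁.join t} := by
      simpa only [eq_comm] using hel
    obtain ⟨f, ⟨hf0, hf⟩, hfl⟩ := exists_isLeast_join_eq ζ₂ ξ
    have hfl' : f ∈ lowerBounds {t : ℝ | 0 ≤ t ∧ ξ.join t = ζ₂.join t} := by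
      simpa only [eq_comm] using hfl
    have key : ∀ {α β : BerkovichA1 K} {c m : ℝ},
        c ∈ lowerBounds {t : ℝ | 0 ≤ t ∧ α.join t = β.join t} → 0 ≤ m → m ≤ c →
        (α.join m : BerkovichP1 K) ∈ hull {(α : BerkovichP1 K), (β : BerkovichP1 K)} :=
      fun hc hm hmc => chain_subset_hull hc ⟨_, ⟨hm, hmc⟩, rfl⟩
    -- The median is the point at the smallest of the three meeting heights: two paths have merged
    -- there, and neither has yet passed its meeting with the third.
    rcases le_total d e with hde | hde
    · rcases le_total d f with hdf | hdf
      · exact ⟨ζ₁.join d, isDiskPoint_join h₁ d, key hdl hd0 le_rfl, key hel hd0 hde,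
          hd ▸ key hfl hd0 hdf⟩
      · exact ⟨ζ₂.join f, isDiskPoint_join h₂ f, Set.pair_comm _ _ ▸ key hdl' hf0 hdf,
          hf ▸ Set.pair_comm _ _ ▸ key hel' hf0 (hdf.trans hde), key hfl hf0 le_rfl⟩
    · rcases le_total e f with hef | hef
      · exact ⟨ζ₁.join e, isDiskPoint_join h₁ e, key hdl he0 hde, key hel he0 le_rfl,
          he ▸ Set.pair_comm _ _ ▸ key hfl' he0 hef⟩
      · exact ⟨ζ₂.join f, isDiskPoint_join h₂ f, Set.pair_comm _ _ ▸ key hdl' hf0 (hef.trans hde),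
          hf ▸ Set.pair_comm _ _ ▸ key hel' hf0 hef, key hfl hf0 le_rfl⟩

theorem exists_isOpen_isPreconnected_of_ne {η p : BerkovichP1 K} (hη : IsDiskPoint η)
    (hp : p ≠ η) : ∃ V, IsOpen V ∧ IsPreconnected V ∧ p ∈ V ∧ V ⊆ {η}ᶜ := by
  obtain ⟨a, r, hr, rfl⟩ := hη
  rcases mem_outside_or_exists_mem_ball hr hp with h | ⟨b, -, h⟩
  · exact ⟨_, isOpen_outside a r, isPreconnected_outside a r, h,
      Set.subset_compl_singleton_iff.2 (diskPoint_notMem_outside hr)⟩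
  · exact ⟨_, isOpen_ball b r, isPreconnected_ball b r, h,
      Set.subset_compl_singleton_iff.2 (diskPoint_notMem_ball hr)⟩

theorem isOpen_direction {η : BerkovichP1 K} (hη : IsDiskPoint η) (p : BerkovichP1 K) :
    IsOpen (connectedComponentIn {η}ᶜ p) := by
  refine isOpen_iff_mem_nhds.2 fun q hq => ?_
  obtain ⟨V, hV, hVc, hqV, hVη⟩ :=
    exists_isOpen_isPreconnected_of_ne hη (connectedComponentIn_subset _ _ hq)
  rw [connectedComponentIn_eq hq]
  exact Filter.mem_of_superset (hV.mem_nhds hqV) (hVc.subset_connectedComponentIn hqV hVη)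

/-- The domains of a finite set of disk points are open. -/
theorem isOpen_domain {Γ : Set (BerkovichP1 K)} (hfin : Γ.Finite) (hΓ : ∀ η ∈ Γ, IsDiskPoint η)
    (p : BerkovichP1 K) : IsOpen (connectedComponentIn Γᶜ p) := by
  refine isOpen_iff_mem_nhds.2 fun q hq => ?_
  rw [connectedComponentIn_eq hq]
  have hqΓ : q ∉ Γ := connectedComponentIn_subset _ _ hq
  have hmem : (⋂ η ∈ Γ, connectedComponentIn {η}ᶜ q) ∈ 𝓝 q :=
    (Filter.biInter_mem hfin).2 fun η hη => (isOpen_direction (hΓ η hη) q).mem_nhds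
      (mem_connectedComponentIn fun h => hqΓ (Set.mem_singleton_iff.1 h ▸ hη))
  -- If `s` is in the same direction as `q` at every point of `Γ`, then the segment from `q` to `s`
  -- avoids `Γ`.
  refine Filter.mem_of_superset hmem fun s hs => ?_
  rw [Set.mem_iInter₂] at hs
  refine (isPreconnected_hull_pair q s).subset_connectedComponentIn (subset_hull _ (by simp)) ?_
    (subset_hull _ (by simp : s ∈ _))
  intro t ht htΓ
  have hsub : hull {q, s} ⊆ connectedComponentIn {t}ᶜ q :=
    hull_subset isPreconnected_connectedComponentIn (Set.pair_subset
      (mem_connectedComponentIn fun h => hqΓ (Set.mem_singleton_iff.1 h ▸ htΓ)) (hs t htΓ))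
  exact connectedComponentIn_subset _ _ (hsub ht) rfl

end Topology

/-! ### The Galois action on coefficients. -/

section Galois

variable {k : Type*} [Field k]

theorem gal_mono_zero (g : GalGroup k) (c : k) : g (mono 0 c) = mono 0 c := by
  have := mono_intCast 0 c
  rw [Int.cast_zero] at this
  rw [this, g.commutes]

/-- The constants, as a subfield of the Puiseux series. -/
def constHom (k : Type*) [Field k] : k →+* Puiseux k :=
  (algebraMap (LaurentSeries k) (Puiseux k)).comp HahnSeries.C

theorem constHom_apply (c : k) : constHom k c = mono 0 c := by
  have := mono_intCast 0 c
  rw [Int.cast_zero] at this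
  rw [this]
  rfl

/-- The quotient `g(x^s) / x^s` is a root of unity, since a power of `x^s` lies in `k((x))`; all
such roots already lie in `k`. -/
theorem exists_gal_mono_eq [IsAlgClosed k] (g : GalGroup k) (s : ℚ) :
    ∃ u : k, ∀ c, g (mono s c) = mono s (u * c) := by
  have hm : mono s (1 : k) ≠ 0 := mono_eq_zero_iff.not.2 one_ne_zero
  have hroot : (g (mono s 1) / mono s 1) ^ s.den = 1 := by
    have h1 : mono s (1 : k) ^ s.den =
        algebraMap (LaurentSeries k) (Puiseux k) (HahnSeries.single s.num 1) := by
      rw [mono_pow, one_pow, mul_comm, Rat.mul_den_eq_num, mono_intCast]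
    rw [div_pow, ← map_pow, h1, g.commutes, div_self]
    rw [← h1]
    exact pow_ne_zero _ hm
  have hmonic := monic_X_pow_sub_C (1 : k) s.den_nz
  have hsplit := congrArg (eval₂ (constHom k) (g (mono s 1) / mono s 1))
    ((IsAlgClosed.splits (X ^ s.den - C (1 : k))).eq_prod_roots_of_monic hmonic)
  rw [eval₂_multiset_prod, Multiset.map_map] at hsplit
  simp only [eval₂_sub, eval₂_X_pow, hroot, map_one, eval₂_one, sub_self] at hsplit
  obtain ⟨u, -, hu⟩ := Multiset.mem_map.1 (Multiset.prod_eq_zero_iff.1 hsplit.symm)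
  simp only [Function.comp_apply, eval₂_sub, eval₂_X, eval₂_C, constHom_apply] at hu
  rw [sub_eq_zero, div_eq_iff hm, mono_mul, zero_add, mul_one] at hu
  refine ⟨u, fun c => ?_⟩
  have h2 : ∀ d : k, mono s d = mono 0 d * mono s 1 := fun d => by rw [mono_mul, zero_add, mul_one]
  rw [h2 c, map_mul, gal_mono_zero, hu, mono_mul, zero_add, mul_comm u]

/-- A Puiseux series has finitely many terms of exponent at most `s`. -/
theorem finite_support_inter_Iic (b : Puiseux k) (s : ℚ) :
    {q | q ≤ s ∧ (b : HahnSeries ℚ k).coeff q ≠ 0}.Finite := by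
  obtain ⟨n, L, hL⟩ := mem_puiseuxSubfield.1 b.2
  refine ((Set.finite_Icc L.order ⌊s * n⌋).image fun z : ℤ => (z : ℚ) / n).subset ?_
  rintro q ⟨hq, hne⟩
  rw [← hL] at hne
  by_cases hz : ∃ z : ℤ, q = (z : ℚ) / n
  · obtain ⟨z, rfl⟩ := hz
    rw [coeff_ramify] at hne
    refine ⟨z, ⟨HahnSeries.order_le_of_coeff_ne_zero hne, Int.le_floor.2 ?_⟩, rfl⟩
    rwa [div_le_iff₀ (by exact_mod_cast n.pos)] at hq
  · push Not at hz
    exact absurd (coeff_ramify_eq_zero n L q hz) hne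

/-- The Galois group acts on the coefficients at a given exponent by a character. -/
theorem exists_coeff_gal_eq [IsAlgClosed k] (g : GalGroup k) (s : ℚ) :
    ∃ u : k, ∀ b : Puiseux k,
      (g b : HahnSeries ℚ k).coeff s = u * (b : HahnSeries ℚ k).coeff s := by
  choose u hu using exists_gal_mono_eq g
  refine ⟨u s, fun b => ?_⟩
  let F := (finite_support_inter_Iic b s).toFinset
  have hF : ∀ q, q ∈ F ↔ q ≤ s ∧ (b : HahnSeries ℚ k).coeff q ≠ 0 := fun q => by simp [F]
  -- The truncation of `b` after `x^s` is a finite sum of monomials, and `g` is an isometry, so the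
  -- tail does not affect the coefficient at `s`.
  let v : Puiseux k := ∑ q ∈ F, mono q ((b : HahnSeries ℚ k).coeff q)
  have hcoeff : ∀ (w : ℚ → k) (q : ℚ),
      ((∑ q' ∈ F, mono q' (w q') : Puiseux k) : HahnSeries ℚ k).coeff q =
        if q ∈ F then w q else 0 := by
    intro w q
    rw [AddSubmonoidClass.coe_finsetSum, HahnSeries.coeff_sum]
    simp only [coe_mono, HahnSeries.coeff_single]
    convert Finset.sum_ite_eq F q w
  have hsmall : ‖b - v‖ < Real.exp (-(s : ℝ)) := by
    rw [norm_puiseux, hahnAbs_lt_exp_iff]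
    intro q hq
    rw [AddSubgroupClass.coe_sub, HahnSeries.coeff_sub, hcoeff]
    split_ifs with h
    · exact sub_self _
    · rw [sub_zero]
      by_contra hne
      exact h ((hF q).2 ⟨hq, hne⟩)
  rw [← norm_gal g, norm_puiseux, hahnAbs_lt_exp_iff] at hsmall
  have h1 := hsmall s le_rfl
  rw [map_sub, AddSubgroupClass.coe_sub, HahnSeries.coeff_sub, sub_eq_zero] at h1
  rw [h1, map_sum]
  simp only [hu]
  rw [hcoeff]
  split_ifs with h
  · rfl
  · by_cases hb : (b : HahnSeries ℚ k).coeff s = 0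
    · rw [hb, mul_zero]
    · exact absurd ((hF s).2 ⟨le_rfl, hb⟩) h

/-- The exponents in the `i`-th term lie in `i s + ℤ`, and these cosets are distinct for `i <
s.den`, so a term of the leading coefficient cannot cancel. -/
theorem aeval_mono_ne_zero {s : ℚ} {q : (LaurentSeries k)[X]} (hq : q ≠ 0)
    (hd : q.natDegree < s.den) : aeval (mono s (1 : k)) q ≠ 0 := by
  intro h0
  obtain ⟨z, hz⟩ : ∃ z, q.leadingCoeff.coeff z ≠ 0 := by
    by_contra! h
    exact hq (leadingCoeff_eq_zero.1 (HahnSeries.ext (funext h)))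
  have h1 := congrArg (fun b : Puiseux k => (b : HahnSeries ℚ k).coeff (q.natDegree * s + z)) h0
  simp only [aeval_eq_sum_range, Algebra.smul_def] at h1
  rw [AddSubmonoidClass.coe_finsetSum, HahnSeries.coeff_sum, Finset.sum_eq_single q.natDegree] at h1
  · rw [mul_comm, mono_pow, one_pow, MulMemClass.coe_mul, coe_mono, HahnSeries.coeff_single_mul,
      one_mul, coe_algebraMap] at h1
    have h2 := coeff_ramify 1 q.leadingCoeff z
    simp only [PNat.one_coe, Nat.cast_one, div_one] at h2
    rw [add_sub_cancel_left] at h1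
    exact hz (h2.symm.trans h1)
  · intro i hi hne
    rw [mul_comm, mono_pow, one_pow, MulMemClass.coe_mul, coe_mono, HahnSeries.coeff_single_mul,
      one_mul, coe_algebraMap]
    refine coeff_ramify_eq_zero _ _ _ fun w hw => ?_
    have hi' : i < q.natDegree :=
      lt_of_le_of_ne (Nat.lt_succ_iff.1 (Finset.mem_range.1 hi)) hne
    have h3 : ((q.natDegree - i : ℕ) : ℚ) * s = ((w - z : ℤ) : ℚ) := by
      simp only [PNat.one_coe, Nat.cast_one, div_one] at hw
      rw [Nat.cast_sub hi'.le]
      push_cast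
      linarith
    have h4 : ((q.natDegree - i : ℕ) : ℤ) * s.num = (w - z) * s.den := by
      have : ((q.natDegree - i : ℕ) : ℚ) * (s.num / s.den) = ((w - z : ℤ) : ℚ) := by
        rw [Rat.num_div_den, h3]
      have hden : (s.den : ℚ) ≠ 0 := by exact_mod_cast s.den_nz
      field_simp at this
      rw [mul_comm (w - z)]
      exact_mod_cast this
    have h5 : (s.den : ℤ) ∣ ((q.natDegree - i : ℕ) : ℤ) := by
      refine IsCoprime.dvd_of_dvd_mul_right (z := s.num) ?_ ⟨w - z, by rw [h4, mul_comm]⟩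
      rw [Int.isCoprime_iff_nat_coprime]
      simpa using s.reduced.symm
    have := Nat.le_of_dvd (Nat.sub_pos_of_lt hi') (by exact_mod_cast h5)
    omega
  · simp

theorem minpoly_mono (s : ℚ) :
    minpoly (LaurentSeries k) (mono s (1 : k)) = X ^ s.den - C (HahnSeries.single s.num 1) := by
  symm
  refine minpoly.unique' _ _ (monic_X_pow_sub_C _ s.den_nz) ?_ fun q hq => ?_
  · rw [map_sub, map_pow, aeval_X, aeval_C, mono_pow, one_pow, mul_comm, Rat.mul_den_eq_num,
      mono_intCast, sub_self]
  · rw [degree_X_pow_sub_C s.pos] at hq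
    by_cases h : q = 0
    · exact Or.inl h
    · exact Or.inr (aeval_mono_ne_zero h ((natDegree_lt_iff_degree_lt h).2 hq))

variable [IsAlgClosed k]

/-- The character by which the Galois group acts on the coefficients at `s`. -/
def coeffChar (s : ℚ) : GalGroup k →* k where
  toFun g := (g (mono s 1) : HahnSeries ℚ k).coeff s
  map_one' := HahnSeries.coeff_single_same s 1
  map_mul' g h := by
    obtain ⟨u, hu⟩ := exists_coeff_gal_eq g s
    rw [AlgEquiv.mul_apply, hu, hu, coe_mono, HahnSeries.coeff_single_same, mul_one]

theorem coeff_gal (g : GalGroup k) (s : ℚ) (b : Puiseux k) :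
    (g b : HahnSeries ℚ k).coeff s = coeffChar s g * (b : HahnSeries ℚ k).coeff s := by
  obtain ⟨u, hu⟩ := exists_coeff_gal_eq g s
  change _ = (g (mono s 1) : HahnSeries ℚ k).coeff s * _
  rw [hu, hu, coe_mono, HahnSeries.coeff_single_same, mul_one]

variable [CharZero k]

theorem exists_isPrimitiveRoot_coeffChar (s : ℚ) :
    ∃ g : GalGroup k, IsPrimitiveRoot (coeffChar s g) s.den := by
  have : NeZero (s.den : k) := ⟨Nat.cast_ne_zero.2 s.den_nz⟩
  obtain ⟨ω, hω⟩ := HasEnoughRootsOfUnity.exists_primitiveRoot k s.den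
  have : Normal (LaurentSeries k) (Puiseux k) :=
    ⟨fun _ => IsAlgClosed.splits _⟩
  obtain ⟨g, hg⟩ := minpoly.exists_algEquiv_of_root' (K := LaurentSeries k)
    (x := mono s ω) (Algebra.IsAlgebraic.isAlgebraic (mono s (1 : k))) (by
      rw [minpoly_mono, map_sub, map_pow, aeval_X, aeval_C, mono_pow, hω.pow_eq_one, mul_comm,
        Rat.mul_den_eq_num, mono_intCast, sub_self])
  refine ⟨g, ?_⟩
  change IsPrimitiveRoot ((g (mono s 1) : HahnSeries ℚ k).coeff s) s.den
  rwa [hg, coe_mono, HahnSeries.coeff_single_same]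

/-- The image of the character contains a root of unity of exact order `s.den`, and the index of the
kernel is the order of the image. -/
theorem den_dvd_index_ker (s : ℚ) : s.den ∣ (coeffChar (k := k) s).ker.index := by
  obtain ⟨g, hg⟩ := exists_isPrimitiveRoot_coeffChar (k := k) s
  have hker : (coeffChar (k := k) s).ker = (coeffChar (k := k) s).toHomUnits.ker := by
    ext h
    rw [MonoidHom.mem_ker, MonoidHom.mem_ker, Units.ext_iff]
    rfl
  rw [hker, Subgroup.index_ker]
  have h1 : Subgroup.zpowers ((coeffChar s).toHomUnits g) ≤ (coeffChar (k := k) s).toHomUnits.range :=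
    Subgroup.zpowers_le.2 ⟨g, rfl⟩
  have h2 := Subgroup.card_dvd_of_le h1
  rwa [Nat.card_zpowers, ← orderOf_units, MonoidHom.coe_toHomUnits, ← hg.eq_orderOf] at h2

end Galois

/-! ### Multiplicities of points in the directions at a disk point. -/

section Multiplicity

variable {k : Type*} [Field k]

theorem ptDist_gal_smul (g : GalGroup k) (ζ : BerkovichA1 (Puiseux k)) (b : Puiseux k) :
    (g • ζ).ptDist (g b) = ζ.ptDist b := by
  change ζ ((X - C (g b)).map (g⁻¹ : GalGroup k).toRingHom) = ζ (X - C b)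
  rw [Polynomial.map_sub, map_X, map_C]
  congr 3
  change (g⁻¹ * g) b = b
  rw [inv_mul_cancel, AlgEquiv.one_apply]

theorem IsTypeII.isDiskPoint {ζ : Pt k} (h : IsTypeII ζ) : IsDiskPoint ζ := by
  obtain ⟨a, s, rfl⟩ := h
  exact ⟨a, _, Real.exp_pos _, rfl⟩

/-- Elements of the completion are approximated by `𝕂` to within `r`, but a disk point stays at
distance at least `r` from `𝕂`. Hence a disk point that is not of Type II has `genMult` equal to
`⊤`. -/
theorem IsDiskPoint.not_isTypeI {ζ : Pt k} (h : IsDiskPoint ζ) : ¬IsTypeI ζ := by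
  obtain ⟨a, r, hr, rfl⟩ := h
  rintro (h | ⟨ξ, z, h, hz⟩)
  · exact OnePoint.coe_ne_infty _ h
  obtain rfl := OnePoint.coe_injective h
  obtain ⟨b, hb⟩ := (UniformSpace.Completion.denseRange_coe (α := Puiseux k)).exists_dist_lt z hr
  have h1 := hz (X - C b)
  rw [eval₂_sub, eval₂_X, eval₂_C] at h1
  rw [dist_eq_norm] at hb
  exact absurd (h1.trans_lt hb) (not_lt.2 (BerkovichA1.le_ptDist_diskPoint a b r hr))

variable [IsAlgClosed k] [CharZero k]

theorem gal_smul_zeta (g : GalGroup k) (a : Puiseux k) (s : ℚ) :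
    g • zeta a s = zeta (g a) s := by
  rw [zeta, gal_smul_coe]
  refine congrArg _ (BerkovichA1.ext_ptDist fun b => ?_)
  obtain ⟨b, rfl⟩ := g.surjective b
  rw [ptDist_gal_smul, BerkovichA1.ptDist_diskPoint, BerkovichA1.ptDist_diskPoint, ← map_sub,
    norm_gal]

/-- The centre moves only among the roots of its minimal polynomial. Finiteness ensures that `toNat`
in `genMult` is the true orbit size and not the default 0. -/
theorem finite_orbit_zeta (a : Puiseux k) (s : ℚ) :
    (MulAction.orbit (GalGroup k) (zeta a s)).Finite := by
  have hint : IsIntegral (LaurentSeries k) a := Algebra.IsIntegral.isIntegral a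
  refine ((((minpoly (LaurentSeries k) a).map (algebraMap _ (Puiseux k))).roots.finite_toSet).image
    fun b => zeta b s).subset ?_
  rintro _ ⟨g, rfl⟩
  refine ⟨g a, ?_, (gal_smul_zeta g a s).symm⟩
  change g a ∈ roots _
  rw [mem_roots ((minpoly.monic hint).map _).ne_zero, IsRoot.def, eval_map_algebraMap]
  have := aeval_algHom_apply g.toAlgHom a (minpoly (LaurentSeries k) a)
  rw [minpoly.aeval, map_zero] at this
  exact this

theorem mult_zeta (a : Puiseux k) (s : ℚ) : mult (zeta a s) = ((mult (zeta a s)).toNat : ℕ∞) :=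
  (ENat.natCast_toNat ((Set.encard_ne_top_iff).2 (finite_orbit_zeta a s))).symm

theorem mult_le_genMult (ζ : Pt k) : mult ζ ≤ genMult ζ := by
  by_cases h : IsTypeII ζ
  · obtain ⟨a, s, rfl⟩ := h
    rw [genMult_zeta]
    conv_lhs => rw [mult_zeta]
    have hpos : 0 < (mult (zeta a s)).toNat := by
      rw [Nat.pos_iff_ne_zero]
      intro h0
      have h1 := mult_zeta a s
      rw [h0, Nat.cast_zero, mult, Set.encard_eq_zero] at h1
      exact (MulAction.nonempty_orbit (M := GalGroup k) (zeta a s)).ne_empty h1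
    exact_mod_cast Nat.le_of_dvd (Nat.lcm_pos hpos s.pos) (Nat.dvd_lcm_left _ _)
  · rw [genMult, dif_neg h]
    split_ifs
    · exact le_rfl
    · exact le_top

/-- The points of the direction at `ζ(b, |x|^s)` containing `b` have multiplicity at least the
generic one, as soon as `x^s` occurs in `b`. -/
theorem genMult_zeta_le_mult {b : Puiseux k} {s : ℚ} (hb : (b : HahnSeries ℚ k).coeff s ≠ 0)
    {p : Pt k} (hp : p ∈ ball b (Real.exp (-(s : ℝ)))) : genMult (zeta b s) ≤ mult p := by
  by_cases hfin : (MulAction.orbit (GalGroup k) p).Finite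
  swap
  · rw [mult, Set.encard_eq_top_iff.2 hfin]
    exact le_top
  obtain ⟨ξ, hξ, rfl⟩ := hp
  -- If `g` fixes `p`, then `b` and `g b` are equally close to `p`, so they differ by less than the
  -- radius.
  have hstab : ∀ g ∈ MulAction.stabilizer (GalGroup k) (ξ : Pt k),
      ‖g b - b‖ < Real.exp (-(s : ℝ)) := by
    intro g hg
    rw [MulAction.mem_stabilizer_iff, gal_smul_coe] at hg
    have hg' := OnePoint.coe_injective hg
    have h1 := ptDist_gal_smul g ξ b
    rw [hg'] at h1
    exact (ξ.norm_sub_le_max _ _).trans_lt (max_lt (h1.trans_lt hξ) hξ)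
  have h1 : MulAction.stabilizer (GalGroup k) (ξ : Pt k) ≤
      MulAction.stabilizer (GalGroup k) (zeta b s) := by
    intro g hg
    rw [MulAction.mem_stabilizer_iff, gal_smul_zeta]
    exact congrArg _ (diskPoint_eq_of_norm_sub_le _ (hstab g hg).le)
  have h2 : MulAction.stabilizer (GalGroup k) (ξ : Pt k) ≤ (coeffChar s).ker := by
    intro g hg
    have h := hstab g hg
    rw [norm_puiseux, hahnAbs_lt_exp_iff] at h
    have h' := h s le_rfl
    rw [AddSubgroupClass.coe_sub, HahnSeries.coeff_sub, coeff_gal, sub_eq_zero] at h'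
    exact (mul_eq_right₀ hb).1 h'
  have h3 := (den_dvd_index_ker s).trans (Subgroup.index_dvd_of_le h2)
  have h4 := Subgroup.index_dvd_of_le h1
  rw [MulAction.index_stabilizer] at h3 h4
  rw [MulAction.index_stabilizer] at h4
  have h5 : mult (ξ : Pt k) = _ := hfin.cast_ncard_eq.symm
  rw [genMult_zeta, h5, Nat.cast_le]
  exact Nat.le_of_dvd ((Set.ncard_pos hfin).2 (MulAction.nonempty_orbit _)) (Nat.lcm_dvd h4 h3)

/-- The hull condition puts `p` and `q` in different directions, so `|b - c| = r`. Hence `r = |x|^s`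
with `s` rational, and `x^s` occurs in `b - c`, so in `b` or in `c`. -/
theorem isTypeII_of_mem_ball_of_mem_hull {η p q : Pt k} {a b c : Puiseux k} {r : ℝ} (hr : 0 < r)
    (hη : η = (diskPoint a r hr : BerkovichA1 (Puiseux k))) (hb : ‖a - b‖ ≤ r) (hc : ‖a - c‖ ≤ r)
    (hp : p ∈ ball b r) (hq : q ∈ ball c r) (h : η ∈ hull {p, q}) :
    IsTypeII η ∧ (genMult η ≤ mult p ∨ genMult η ≤ mult q) := by
  have hbc : ‖b - c‖ = r := by
    refine le_antisymm ?_ ?_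
    · rw [← sub_add_sub_cancel b a c]
      exact (IsUltrametricDist.norm_add_le_max _ _).trans (max_le (norm_sub_rev a b ▸ hb) hc)
    · by_contra! hlt
      have := hull_subset (isPreconnected_ball c r) (Set.pair_subset (ball_subset_ball hlt hp) hq) h
      rw [hη] at this
      exact diskPoint_notMem_ball hr this
  have hne : ((b - c : Puiseux k) : HahnSeries ℚ k) ≠ 0 := by
    intro h0
    rw [norm_puiseux, h0, map_zero] at hbc
    exact hr.ne hbc
  set s := ((b - c : Puiseux k) : HahnSeries ℚ k).order with hs
  obtain rfl : r = Real.exp (-(s : ℝ)) := by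
    rw [← hbc, norm_puiseux, hahnAbs_of_ne_zero hne]
  have hcoeff : ((b - c : Puiseux k) : HahnSeries ℚ k).coeff s ≠ 0 :=
    HahnSeries.coeff_order_eq_zero.not.2 hne
  have hηb : η = zeta b s := hη.trans (congrArg _ (diskPoint_eq_of_norm_sub_le hr hb))
  have hηc : η = zeta c s := hη.trans (congrArg _ (diskPoint_eq_of_norm_sub_le hr hc))
  refine ⟨⟨b, s, hηb⟩, ?_⟩
  by_cases hb0 : (b : HahnSeries ℚ k).coeff s = 0
  · right
    rw [hηc]
    refine genMult_zeta_le_mult (fun hc0 => hcoeff ?_) hq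
    rw [AddSubgroupClass.coe_sub, HahnSeries.coeff_sub, hb0, hc0, sub_zero]
  · left
    rw [hηb]
    exact genMult_zeta_le_mult hb0 hp

/-- Among three directions at a disk point, one has at least the generic multiplicity. -/
theorem isTypeII_of_mem_hull {η p₁ p₂ p₃ : Pt k} (hη : IsDiskPoint η)
    (h₁ : p₁ ≠ η) (h₂ : p₂ ≠ η) (h₃ : p₃ ≠ η)
    (h₁₂ : η ∈ hull {p₁, p₂}) (h₁₃ : η ∈ hull {p₁, p₃}) (h₂₃ : η ∈ hull {p₂, p₃}) :
    IsTypeII η ∧ (genMult η ≤ mult p₁ ∨ genMult η ≤ mult p₂ ∨ genMult η ≤ mult p₃) := by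
  obtain ⟨a, r, hr, hη'⟩ := hη
  -- The direction of `∞` contains at most one of the three points, so at least two lie in balls.
  have hout : ∀ {p q : Pt k}, p ∈ outside a r → q ∈ outside a r → η ∉ hull {p, q} := by
    intro p q hp hq h
    have := hull_subset (isPreconnected_outside a r) (Set.pair_subset hp hq) h
    rw [hη'] at this
    exact diskPoint_notMem_outside hr this
  rw [hη'] at h₁ h₂ h₃
  rcases mem_outside_or_exists_mem_ball hr h₁ with h₁ | ⟨b₁, hb₁, h₁⟩
  · rcases mem_outside_or_exists_mem_ball hr h₂ with h₂ | ⟨b₂, hb₂, h₂⟩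
    · exact absurd h₁₂ (hout h₁ h₂)
    · rcases mem_outside_or_exists_mem_ball hr h₃ with h₃ | ⟨b₃, hb₃, h₃⟩
      · exact absurd h₁₃ (hout h₁ h₃)
      · exact (isTypeII_of_mem_ball_of_mem_hull hr hη' hb₂ hb₃ h₂ h₃ h₂₃).imp_right Or.inr
  · rcases mem_outside_or_exists_mem_ball hr h₂ with h₂ | ⟨b₂, hb₂, h₂⟩
    · rcases mem_outside_or_exists_mem_ball hr h₃ with h₃ | ⟨b₃, hb₃, h₃⟩
      · exact absurd h₂₃ (hout h₂ h₃)
      · exact (isTypeII_of_mem_ball_of_mem_hull hr hη' hb₁ hb₃ h₁ h₃ h₁₃).imp_right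
          (Or.imp_right Or.inr)
    · exact (isTypeII_of_mem_ball_of_mem_hull hr hη' hb₁ hb₂ h₁ h₂ h₁₂).imp_right
        (Or.imp_right Or.inl)

end Multiplicity

/-! ### Boundaries of domains. -/

section Domains

variable {T : Type*} [TopologicalSpace T]

/-- The boundary of a domain is contained in the vertex set, if domains are open. -/
theorem frontier_domain_subset {Γ : Set T}
    (hopen : ∀ p, IsOpen (connectedComponentIn Γᶜ p)) (p : T) :
    frontier (connectedComponentIn Γᶜ p) ⊆ Γ := by
  intro q hq
  by_contra hqΓ
  rw [(hopen p).frontier_eq] at hq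
  obtain ⟨t, htq, htp⟩ := mem_closure_iff.1 hq.1 _ (hopen q) (mem_connectedComponentIn hqΓ)
  apply hq.2
  rw [connectedComponentIn_eq htp, ← connectedComponentIn_eq htq]
  exact mem_connectedComponentIn hqΓ

/-- Only the chosen boundary points are added, which confines a segment between boundary points to
`U` and its own ends. -/
theorem isPreconnected_union_of_subset_frontier {U S : Set T} (hU : IsPreconnected U)
    (hS : S ⊆ frontier U) : IsPreconnected (U ∪ S) :=
  hU.subset_closure Set.subset_union_left
    (Set.union_subset subset_closure (hS.trans frontier_subset_closure))

/-- A connected open set with a single boundary point is a direction at that point. -/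
theorem mem_directions_of_frontier_eq {U : Set T} {ζ : T} (hU : IsPreconnected U) (hUo : IsOpen U)
    (hne : U.Nonempty) (hf : frontier U = {ζ}) : U ∈ directions ζ := by
  obtain ⟨p, hp⟩ := hne
  have hζ : ζ ∈ frontier U := hf ▸ rfl
  rw [hUo.frontier_eq] at hζ
  have hsub : U ⊆ {ζ}ᶜ := fun q hq h => hζ.2 (Set.mem_singleton_iff.1 h ▸ hq)
  refine ⟨p, hsub hp, (hU.subset_connectedComponentIn hp hsub).antisymm ?_⟩
  -- `U` is relatively closed in the complement of `ζ`, since its only boundary point is `ζ`; being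
  -- open too, it exhausts the component.
  refine isPreconnected_connectedComponentIn.subset_of_closure_inter_subset hUo
    ⟨p, mem_connectedComponentIn (hsub hp), hp⟩ ?_
  rintro q ⟨hq, hqc⟩
  by_contra hqU
  have : q ∈ frontier U := by
    rw [hUo.frontier_eq]
    exact ⟨hq, hqU⟩
  rw [hf] at this
  exact connectedComponentIn_subset _ _ hqc this

end Domains

/-! ### The dichotomy between generic directions and annuli. -/

section Main

variable {k : Type*} [Field k] [IsAlgClosed k] [CharZero k]

/-- In a smoothly `n`-convex vertex set, the points other than `ζ₁` and `ζ₂` in the closure of a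
domain with boundary points `ζ₁` and `ζ₂` have generic multiplicity greater than `n`. -/
theorem lt_genMult_of_mem_union_frontier {n : ℕ} {Γ : Set (Pt k)} (hΓ : IsSmoothlyNConvex n Γ)
    {U : Set (Pt k)} (hU : IsPreconnected U) (hUΓ : U ⊆ Γᶜ) {ζ₁ ζ₂ ξ : Pt k} (hne : ζ₁ ≠ ζ₂)
    (hf₁ : ζ₁ ∈ frontier U) (hf₂ : ζ₂ ∈ frontier U) (h₁ : ζ₁ ∈ Γ) (h₂ : ζ₂ ∈ Γ)
    (hξ₁ : ξ ≠ ζ₁) (hξ₂ : ξ ≠ ζ₂) (hξ : ξ ∈ U ∪ frontier U) : (n : ℕ∞) < genMult ξ := by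
  obtain ⟨η, hη, h₁₂, h₁₃, h₂₃⟩ := exists_isDiskPoint_mem_hull
    (hΓ.isVertexSet.2 _ h₁).isDiskPoint (hΓ.isVertexSet.2 _ h₂).isDiskPoint ξ
  have hsub : ∀ {p q : Pt k}, p ∈ U ∪ frontier U → q ∈ U ∪ frontier U →
      hull {p, q} ⊆ U ∪ ({p, q} ∩ frontier U) := by
    intro p q hp hq
    exact hull_subset (isPreconnected_union_of_subset_frontier hU Set.inter_subset_right)
      (Set.pair_subset (hp.imp_right fun h => ⟨by simp, h⟩) (hq.imp_right fun h => ⟨by simp, h⟩))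
  -- Outside `U` the median would be an end of all three segments at once, but no point belongs to
  -- all three pairs taken from distinct `ζ₁`, `ζ₂`, `ξ`.
  have hηU : η ∈ U := by
    by_contra hηU
    have h3 := ((hsub (Or.inr hf₁) hξ h₁₃).resolve_left hηU).1
    have h4 := ((hsub (Or.inr hf₂) hξ h₂₃).resolve_left hηU).1
    rcases ((hsub (Or.inr hf₁) (Or.inr hf₂) h₁₂).resolve_left hηU).1 with rfl | rfl
    · rcases h4 with h | h
      · exact hne h
      · exact hξ₁ h.symm
    · rcases h3 with h | h
      · exact hne h.symm
      · exact hξ₂ h.symm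
  have hηΓ : η ∉ Γ := hUΓ hηU
  have hgen : IsTypeII η → (n : ℕ∞) < genMult η := by
    intro hII
    by_contra! hle
    refine hηΓ ?_
    rw [hΓ.isNConvex.2]
    exact ⟨hull_mono (Set.pair_subset h₁ h₂) h₁₂, hII, hle⟩
  by_cases hηξ : η = ξ
  · subst hηξ
    by_cases hII : IsTypeII η
    · exact hgen hII
    · rw [genMult, dif_neg hII, if_neg hη.not_isTypeI]
      exact ENat.natCast_lt_top n
  -- This excludes `ζ₁` and `ζ₂` as the point whose multiplicity reaches `genMult η > n`, leaving
  -- `ξ`.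
  have hle : ∀ ζ ∈ Γ, mult ζ ≤ n := fun ζ hζ =>
    (mult_le_genMult ζ).trans (hΓ.isNConvex.1 hζ).2
  obtain ⟨hII, h | h | h⟩ := isTypeII_of_mem_hull hη (fun h => hηΓ (h ▸ h₁)) (fun h => hηΓ (h ▸ h₂))
    (Ne.symm hηξ) h₁₂ h₁₃ h₂₃
  · exact absurd (h.trans (hle _ h₁)) (not_le.2 (hgen hII))
  · exact absurd (h.trans (hle _ h₂)) (not_le.2 (hgen hII))
  · exact (hgen hII).trans_le (h.trans (mult_le_genMult ξ))

theorem isGenericDirection_or_annulus {n : ℕ} {Γ : Set (Pt k)} (hne : Γ.Nonempty)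
    (hΓ : IsSmoothlyNConvex n Γ) {U : Set (Pt k)} (hU : U ∈ domains Γ) :
    (∃ ζ ∈ Γ, frontier U = {ζ} ∧ IsGenericDirection ζ U) ∨
    (∃ ζ₁ ∈ Γ, ∃ ζ₂ ∈ Γ, ζ₁ ≠ ζ₂ ∧ frontier U = {ζ₁, ζ₂} ∧
      ∀ ξ ∈ U, max (genMult ζ₁) (genMult ζ₂) < genMult ξ) := by
  obtain ⟨p, hp, rfl⟩ := hU
  have hopen := isOpen_domain hΓ.isVertexSet.1 fun ζ hζ => (hΓ.isVertexSet.2 ζ hζ).isDiskPoint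
  have hUo := hopen p
  have hf := frontier_domain_subset hopen p
  have hU : IsPreconnected (connectedComponentIn Γᶜ p) := isPreconnected_connectedComponentIn
  have hpU := mem_connectedComponentIn hp
  have hUΓ := connectedComponentIn_subset Γᶜ p
  set U := connectedComponentIn Γᶜ p
  -- Otherwise `U` would be clopen, hence the whole line, although it misses the non-empty set `Γ`.
  have hfne : (frontier U).Nonempty := by
    rw [Set.nonempty_iff_ne_empty, Ne, ← isClopen_iff_frontier_eq_empty]
    intro hclopen
    have := preconnectedSpace_berkovichP1 (K := Puiseux k)
    rcases isClopen_iff.1 hclopen with h | h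
    · exact (h ▸ hpU : p ∈ (∅ : Set (Pt k)))
    · obtain ⟨ζ, hζ⟩ := hne
      exact hUΓ (h ▸ Set.mem_univ ζ : ζ ∈ U) hζ
  obtain ⟨ζ₁, hζ₁⟩ := hfne
  by_cases hsingle : frontier U = {ζ₁}
  · left
    have hdir := mem_directions_of_frontier_eq hU hUo ⟨p, hpU⟩ hsingle
    refine ⟨ζ₁, hf hζ₁, hsingle, hdir, ?_⟩
    by_contra hspecial
    obtain ⟨ξ, hξ, hξU⟩ := hΓ.isFlanked ζ₁ (hf hζ₁) U ⟨hdir, hspecial⟩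
    exact hUΓ hξU hξ
  · right
    obtain ⟨ζ₂, hζ₂, h21⟩ : ∃ ζ₂ ∈ frontier U, ζ₂ ≠ ζ₁ := by
      by_contra! h
      exact hsingle (Set.eq_singleton_iff_unique_mem.2 ⟨hζ₁, h⟩)
    have key : ∀ ξ, ξ ≠ ζ₁ → ξ ≠ ζ₂ → ξ ∈ U ∪ frontier U → (n : ℕ∞) < genMult ξ := fun ξ =>
      lt_genMult_of_mem_union_frontier hΓ hU hUΓ h21.symm hζ₁ hζ₂ (hf hζ₁) (hf hζ₂)
    refine ⟨ζ₁, hf hζ₁, ζ₂, hf hζ₂, h21.symm, ?_, fun ξ hξ => ?_⟩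
    · refine (Set.pair_subset hζ₁ hζ₂).antisymm' fun ξ hξ => ?_
      by_contra h
      rw [Set.mem_insert_iff, Set.mem_singleton_iff, not_or] at h
      -- A third boundary point would lie in `Γ`, where generic multiplicities are at most `n`.
      exact absurd (hΓ.isNConvex.1 (hf hξ)).2 (not_le.2 (key ξ h.1 h.2 (Or.inr hξ)))
    · refine (max_le (hΓ.isNConvex.1 (hf hζ₁)).2 (hΓ.isNConvex.1 (hf hζ₂)).2).trans_lt ?_
      exact key ξ (fun h => hUΓ hξ (h ▸ hf hζ₁)) (fun h => hUΓ hξ (h ▸ hf hζ₂)) (Or.inl hξ)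

end Main

end

end SkewTree

theorem mainTheorem11 (k : Type*) [Field k] [IsAlgClosed k] [CharZero k]
    (n : ℕ) (Γ : Set (SkewTree.Pt k)) (hne : Γ.Nonempty)
    (hΓ : SkewTree.IsSmoothlyNConvex n Γ) :
    SkewTree.IsSmooth Γ ∧
    ∀ U ∈ SkewTree.domains Γ,
      (∃ ζ ∈ Γ, frontier U = {ζ} ∧ SkewTree.IsGenericDirection ζ U) ∨
      (∃ ζ₁ ∈ Γ, ∃ ζ₂ ∈ Γ, ζ₁ ≠ ζ₂ ∧ frontier U = {ζ₁, ζ₂} ∧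
        ∀ ξ ∈ U, max (SkewTree.genMult ζ₁) (SkewTree.genMult ζ₂) < SkewTree.genMult ξ) := by
  refine ⟨⟨hΓ.isVertexSet, hΓ.isGeometric, fun U hU => ?_⟩,
    fun U hU => SkewTree.isGenericDirection_or_annulus hne hΓ hU⟩
  rcases SkewTree.isGenericDirection_or_annulus hne hΓ hU with
    ⟨ζ, -, h, hgen⟩ | ⟨ζ₁, -, ζ₂, -, hne', h, hlt⟩
  · exact Or.inl ⟨ζ, h, hgen.2⟩
  · exact Or.inr ⟨ζ₁, ζ₂, hne', h, hlt⟩
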